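/- Let $n\ge 2$ and $m\ge 1$ be integers, and let $\Omega\subset\mathbb R^n$ be open, bounded and connected, with $0\in\Omega$, such that - $\Omega$ is convex in the $x_1$-direction: if $p,q\in\Omega$ and $p_j=q_j$ for all $j\in\{2,\dots,n\}$, then $(1-t)p+tq\in\Omega$ for all $t\in[0,1]$; - $\Omega$ is symmetric with respect to $\{x_1=0\}$: if $(p_1,p_2,\dots,p_n)\in\Omega$ then $(-p_1,p_2,\dots,p_n)\in\Omega$. Let $f:[0,\infty)\to\mathbb R$ be (globally) Lipschitz continuous and non-decreasing, with $f(0)\ge 0$. Let $u\in C^{2m}(\Omega\setminus\{0\})\cap C^{2m-2}(\overline\Omega\setminus\{0\})$ (the second condition meaning that all derivatives of $u$ of order at most $2m-2$ extend continuously from $\Omega\setminus\{0\}$ to $\overline\Omega\setminus\{0\}$) be a classical solution of $$ \begin{cases} (-\Delta)^m u=f(u) & \text{in }\Omega\setminus\{0\},\\ u>0 & \text{in }\Omega\setminus\{0\},\\ u=-\Delta u=\dots=(-\Delta)^{m-1}u=0 & \text{on }\partial\Omega,\\ \inf_{\Omega\setminus\{0\}}(-\Delta)^j u>-\infty & \text{for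 } j=1,\dots,m-1. \end{cases} $$ Then: 1. $u$ is symmetric in $x_1$: $u(-x_1,x_2,\dots,x_n)=u(x_1,x_2,\dots,x_n)$ for every $x\in\Omega\setminus\{0\}$; 2. $u$ is strictly decreasing with respect to $x_1$ on $\Omega\cap\{x_1>0\}$: if $x,y\in\Omega$ satisfy $x_j=y_j$ for all $j\in\{2,\dots,n\}$ and $0<x_1<y_1$, then $u(y)<u(x)$. In particular, if $\Omega=\{x\in\mathbb R^n:|x|<R\}$ for some $R>0$, then $u$ is radial and strictly radially decreasing: there is a function $\varphi$, strictly decreasing on $(0,R)$, with $u(x)=\varphi(|x|)$ for all $x\in\Omega\setminus\{0\}$. -/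

import Mathlib

open Set Filter Topology
open scoped NNReal

/-- The operator `-Δ` on real functions on `ℝⁿ`, where `Δ` is Mathlib's Laplacian. The value at a
point only depends on the function near that point. The power `(-Δ)^j` is `negLaplacian^[j]`. -/
noncomputable def negLaplacian {n : ℕ} (v : EuclideanSpace ℝ (Fin n) → ℝ) :
    EuclideanSpace ℝ (Fin n) → ℝ :=
  fun x => -(Laplacian.laplacian v x)

/-- The reflection of `ℝⁿ` that changes the sign of the `i`-th coordinate. -/
noncomputable def coordReflection {n : ℕ} (i : Fin n) (x : EuclideanSpace ℝ (Fin n)) :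
    EuclideanSpace ℝ (Fin n) :=
  WithLp.toLp 2 (fun j => if j = i then -(x j) else x j)

/-- A domain (open, bounded, connected) that contains `0`, is convex in the direction of the `i`-th
coordinate, and is symmetric with respect to the hyperplane `x_i = 0`. -/
structure IsSymmetricConvexDomain {n : ℕ} (i : Fin n) (Ω : Set (EuclideanSpace ℝ (Fin n))) :
    Prop where
  isOpen : IsOpen Ω
  isBounded : Bornology.IsBounded Ω
  isConnected : IsConnected Ω
  convex_dir : ∀ p ∈ Ω, ∀ q ∈ Ω, (∀ j, j ≠ i → p j = q j) →
    ∀ t ∈ Icc (0 : ℝ) 1, (1 - t) • p + t • q ∈ Ω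
  reflection_mem : ∀ p ∈ Ω, coordReflection i p ∈ Ω
  zero_mem : (0 : EuclideanSpace ℝ (Fin n)) ∈ Ω

/-- The condition on the nonlinearity `f : [0, ∞) → ℝ` (only the values on `[0, ∞)` matter):
globally Lipschitz, `f 0 ≥ 0`, and non-decreasing. -/
structure IsAdmissibleNonlinearity (f : ℝ → ℝ) : Prop where
  lipschitz : ∃ K : ℝ≥0, LipschitzOnWith K f (Ici 0)
  zero_nonneg : 0 ≤ f 0
  monotone : MonotoneOn f (Ici 0)

/-- The class `C^k(S)` for an open set `U` with `U ⊆ S ⊆ closure U`: the function is of class `C^k`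
in `U`, and all its derivatives of order at most `k` extend continuously from `U` to `S`. -/
def ContDiffUpTo {n : ℕ} (k : ℕ) (v : EuclideanSpace ℝ (Fin n) → ℝ)
    (U S : Set (EuclideanSpace ℝ (Fin n))) : Prop :=
  ContDiffOn ℝ k v U ∧
    ∀ j ≤ k, ∃ g : EuclideanSpace ℝ (Fin n) →
        ContinuousMultilinearMap ℝ (fun _ : Fin j => EuclideanSpace ℝ (Fin n)) ℝ,
      ContinuousOn g S ∧ EqOn g (iteratedFDeriv ℝ j v) U

/-- `u` is a positive classical solution of `(-Δ)^m u = f(u)` in `Ω ∖ {0}` with Navier conditions on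
the boundary of `Ω` and with `(-Δ)^j u` bounded below for `1 ≤ j ≤ m - 1`. Only the values of `u`
on `Ω ∖ {0}` matter. -/
structure IsPositiveNavierSolution {n : ℕ} (m : ℕ) (Ω : Set (EuclideanSpace ℝ (Fin n)))
    (f : ℝ → ℝ) (u : EuclideanSpace ℝ (Fin n) → ℝ) : Prop where
  contDiffOn : ContDiffOn ℝ ((2 * m : ℕ) : WithTop ℕ∞) u (Ω \ {0})
  contDiffUpTo : ContDiffUpTo (2 * m - 2) u (Ω \ {0}) (closure Ω \ {0})
  equation : ∀ x ∈ Ω \ {0}, negLaplacian^[m] u x = f (u x)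
  pos : ∀ x ∈ Ω \ {0}, 0 < u x
  /-- The continuous extension of `(-Δ)^j u` to the boundary vanishes, for `0 ≤ j ≤ m - 1`. -/
  navier : ∀ j < m, ∀ y ∈ frontier Ω, Tendsto (negLaplacian^[j] u) (𝓝[Ω \ {0}] y) (𝓝 0)
  bddBelow : ∀ j, 1 ≤ j → j < m → BddBelow (negLaplacian^[j] u '' (Ω \ {0}))

/-!
Moving planes for a second order system. Put `V j = (-Δ)^j u` for `j < m`, extended by zero, so that
`-Δ (V j) = V (j + 1)` and `-Δ (V (m - 1)) = f (V 0)`. In dimension at least two, a superharmonic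
function that is bounded below obeys the minimum principle across an isolated singularity. Hence
`0 ≤ V j`, and the differences `w j x = V j xˡ - V j x`, where `xˡ` is the mirror image of `x` in
the plane at level `l`, obey it in the cap beyond that plane although they are singular at the
mirror image of `0`.

Suppose `-M ≤ w 0` in the cap. By monotonicity and the Lipschitz bound,
`-Δ (w (m - 1)) ≥ -L M` holds where `w 0` lies below a small multiple of `-M`, and a much better
bound holds elsewhere. If the exceptional set has small volume, comparison with a small potential
bounds `w (m - 1)`, then `w (m - 2)`, and so on down to `w 0`, improving `-M` to `-M / 2`; so
`0 ≤ w 0`. The exceptional set is small if the cap is, or if `w 0 > 0` on a large compact subset of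
it. Thus the levels `l > 0` with `0 ≤ w 0` form a set that is open, closed and contains all large
`l`. Letting `l → 0` in the directions `e` and `-e` gives the symmetry.
-/

section Calculus

open Laplacian
open scoped RealInnerProductSpace

theorem deriv_deriv_nonneg_of_isLocalMin {f : ℝ → ℝ} {a : ℝ} (hf : ContinuousAt f a)
    (hmin : IsLocalMin f a) : 0 ≤ deriv (deriv f) a := by
  by_contra! hneg
  have hmax : IsLocalMax f a := isLocalMax_of_deriv_deriv_neg hneg hmin.deriv_eq_zero hf
  have hconst : f =ᶠ[𝓝 a] fun _ => f a := by
    filter_upwards [hmin, hmax] with t h h' using le_antisymm h' h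
  have hzero : deriv (deriv f) a = 0 := by
    rw [hconst.deriv.deriv_eq]
    simp
  exact hneg.ne hzero

section NormedSpace

variable {E : Type*} [NormedAddCommGroup E] [NormedSpace ℝ E]

theorem deriv_deriv_comp_line {f : E → ℝ} {x : E} (hf : ContDiffAt ℝ 2 f x) (v : E) :
    deriv (deriv fun t : ℝ => f (x + t • v)) 0 = fderiv ℝ (fderiv ℝ f) x v v := by
  have hline : ∀ t : ℝ, HasDerivAt (fun t : ℝ => x + t • v) v t := fun t => by
    simpa using ((hasDerivAt_id t).smul_const v).const_add x
  have hx : x + (0 : ℝ) • v = x := by simp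
  have hdiff : ∀ᶠ y in 𝓝 (x + (0 : ℝ) • v), DifferentiableAt ℝ f y := by
    rw [hx]
    exact (hf.eventually (by simp)).mono fun y hy => hy.differentiableAt (by norm_num)
  have hfirst : deriv (fun t : ℝ => f (x + t • v)) =ᶠ[𝓝 0] fun t => fderiv ℝ f (x + t • v) v := by
    filter_upwards [(hline 0).continuousAt.eventually hdiff] with t ht
    exact (ht.hasFDerivAt.comp_hasDerivAt t (hline t)).deriv
  have hfderiv : DifferentiableAt ℝ (fderiv ℝ f) (x + (0 : ℝ) • v) := by
    rw [hx]
    exact (hf.fderiv_right (m := 1) (by norm_num)).differentiableAt (by norm_num)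
  have hsecond : HasDerivAt (fun t : ℝ => fderiv ℝ f (x + t • v))
      (fderiv ℝ (fderiv ℝ f) x v) 0 := by
    have := hfderiv.hasFDerivAt.comp_hasDerivAt 0 (hline 0)
    rwa [hx] at this
  rw [hfirst.deriv_eq]
  exact (((ContinuousLinearMap.apply ℝ ℝ v).hasFDerivAt).comp_hasDerivAt 0 hsecond).deriv

theorem fderiv_fderiv_nonneg_of_isLocalMin {f : E → ℝ} {x : E} (hf : ContDiffAt ℝ 2 f x)
    (hmin : IsLocalMin f x) (v : E) : 0 ≤ fderiv ℝ (fderiv ℝ f) x v v := by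
  have hline : ContinuousAt (fun t : ℝ => x + t • v) 0 := by fun_prop
  have hx : x + (0 : ℝ) • v = x := by simp
  rw [← deriv_deriv_comp_line hf]
  refine deriv_deriv_nonneg_of_isLocalMin (ContinuousAt.comp (hx.symm ▸ hf.continuousAt) hline) ?_
  have := hline.eventually (hx.symm ▸ hmin)
  simpa only [IsLocalMin, IsMinFilter, hx] using this

end NormedSpace

variable {E : Type*} [NormedAddCommGroup E] [InnerProductSpace ℝ E]

theorem contDiffAt_comp_norm_sub_sq {g : ℝ → ℝ} {a x : E} {n : WithTop ℕ∞}
    (hg : ContDiffAt ℝ n g (‖x - a‖ ^ 2)) : ContDiffAt ℝ n (fun y => g (‖y - a‖ ^ 2)) x :=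
  ContDiffAt.comp x hg ((contDiff_id.sub contDiff_const).norm_sq ℝ).contDiffAt

theorem hasFDerivAt_comp_norm_sub_sq {g : ℝ → ℝ} {g' : ℝ} {a x : E}
    (hg : HasDerivAt g g' (‖x - a‖ ^ 2)) :
    HasFDerivAt (fun y => g (‖y - a‖ ^ 2)) ((2 * g') • innerSL ℝ (x - a)) x := by
  refine (hg.comp_hasFDerivAt x ((hasFDerivAt_id x).sub_const a).norm_sq).congr_fderiv ?_
  ext v
  simp only [id_eq, map_sub, ContinuousLinearMap.comp_id, smul_apply, sub_apply,
    coe_innerSL_apply, nsmul_eq_mul, Nat.cast_ofNat, smul_eq_mul]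
  ring

theorem fderiv_fderiv_comp_norm_sub_sq {g g₁ : ℝ → ℝ} {g₂ : ℝ} {a x : E}
    (hg : ∀ᶠ t in 𝓝 (‖x - a‖ ^ 2), HasDerivAt g (g₁ t) t)
    (hg₁ : HasDerivAt g₁ g₂ (‖x - a‖ ^ 2)) (v : E) :
    fderiv ℝ (fderiv ℝ fun y => g (‖y - a‖ ^ 2)) x v v
      = 4 * g₂ * ⟪x - a, v⟫ ^ 2 + 2 * g₁ (‖x - a‖ ^ 2) * ‖v‖ ^ 2 := by
  have hcont : ContinuousAt (fun y : E => ‖y - a‖ ^ 2) x := by fun_prop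
  have hfirst : fderiv ℝ (fun y => g (‖y - a‖ ^ 2)) =ᶠ[𝓝 x]
      fun y => (2 * g₁ (‖y - a‖ ^ 2)) • innerSL ℝ (y - a) := by
    filter_upwards [hcont.eventually hg] with y hy
    exact (hasFDerivAt_comp_norm_sub_sq hy).fderiv
  have hinner : HasFDerivAt (fun y : E => innerSL ℝ (y - a)) (innerSL ℝ) x :=
    (innerSL ℝ).hasFDerivAt.comp x ((hasFDerivAt_id x).sub_const a)
  have hsecond := (((hasFDerivAt_comp_norm_sub_sq hg₁).const_mul 2).smul hinner).fderiv
  simp only [Pi.smul_def'] at hsecond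
  rw [hfirst.fderiv_eq, hsecond]
  simp only [add_apply, smul_apply, ContinuousLinearMap.smulRight_apply, smul_eq_mul]
  rw [innerSL_apply_apply, innerSL_apply_apply, real_inner_self_eq_norm_sq]
  ring

variable [FiniteDimensional ℝ E]

theorem laplacian_eq_sum_fderiv_fderiv {ι : Type*} [Fintype ι] (b : OrthonormalBasis ι ℝ E)
    (f : E → ℝ) (x : E) : Δ f x = ∑ i, fderiv ℝ (fderiv ℝ f) x (b i) (b i) := by
  rw [InnerProductSpace.laplacian_eq_iteratedFDeriv_orthonormalBasis f b]
  simp [iteratedFDeriv_two_apply]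

theorem laplacian_nonneg_of_isLocalMin {f : E → ℝ} {x : E} (hf : ContDiffAt ℝ 2 f x)
    (hmin : IsLocalMin f x) : 0 ≤ Δ f x := by
  rw [laplacian_eq_sum_fderiv_fderiv (stdOrthonormalBasis ℝ E)]
  exact Finset.sum_nonneg fun i _ => fderiv_fderiv_nonneg_of_isLocalMin hf hmin _

theorem laplacian_comp_norm_sub_sq {g g₁ : ℝ → ℝ} {g₂ : ℝ} {a x : E}
    (hg : ∀ᶠ t in 𝓝 (‖x - a‖ ^ 2), HasDerivAt g (g₁ t) t)
    (hg₁ : HasDerivAt g₁ g₂ (‖x - a‖ ^ 2)) :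
    Δ (fun y => g (‖y - a‖ ^ 2)) x
      = 4 * g₂ * ‖x - a‖ ^ 2 + 2 * Module.finrank ℝ E * g₁ (‖x - a‖ ^ 2) := by
  rw [laplacian_eq_sum_fderiv_fderiv (stdOrthonormalBasis ℝ E)]
  simp only [fderiv_fderiv_comp_norm_sub_sq hg hg₁, OrthonormalBasis.norm_eq_one]
  rw [Finset.sum_add_distrib, ← Finset.mul_sum,
    (stdOrthonormalBasis ℝ E).sum_sq_inner_left (x - a), Finset.sum_const, Finset.card_univ,
    Fintype.card_fin, nsmul_eq_mul]
  ring

theorem laplacian_const_mul {w : E → ℝ} {x : E} (c : ℝ) (hw : ContDiffAt ℝ 2 w x) :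
    Δ (fun y => c * w y) x = c * Δ w x :=
  InnerProductSpace.laplacian_smul c hw

theorem laplacian_add_const_mul {v w : E → ℝ} {x : E} (c : ℝ) (hv : ContDiffAt ℝ 2 v x)
    (hw : ContDiffAt ℝ 2 w x) : Δ (fun y => v y + c * w y) x = Δ v x + c * Δ w x := by
  rw [← laplacian_const_mul c hw]
  exact hv.laplacian_add (contDiffAt_const.mul hw)

theorem laplacian_sum {ι : Type*} (s : Finset ι) {v : ι → E → ℝ} {x : E}
    (hv : ∀ i ∈ s, ContDiffAt ℝ 2 (v i) x) :
    Δ (fun y => ∑ i ∈ s, v i y) x = ∑ i ∈ s, Δ (v i) x := by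
  classical
  induction s using Finset.induction_on with
  | empty => simp [InnerProductSpace.laplacian_const]
  | insert i s hi ih =>
    have hs : ∀ j ∈ s, ContDiffAt ℝ 2 (v j) x := fun j hj => hv j (Finset.mem_insert_of_mem hj)
    simp only [Finset.sum_insert hi]
    rw [← ih hs]
    exact (hv i (Finset.mem_insert_self i s)).laplacian_add (ContDiffAt.sum hs)

theorem laplacian_comp_affineIsometry (A : E ≃ₗᵢ[ℝ] E) (c : E) {v : E → ℝ} {x : E}
    (hv : ContDiffAt ℝ 2 v (A x + c)) : Δ (fun y => v (A y + c)) x = Δ v (A x + c) := by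
  have hA : ∀ y, HasFDerivAt (fun y => A y + c) (A : E →L[ℝ] E) y := fun y =>
    (A.toContinuousLinearEquiv : E →L[ℝ] E).hasFDerivAt.add_const c
  have hdiff : ∀ᶠ y in 𝓝 (A x + c), DifferentiableAt ℝ v y :=
    (hv.eventually (by simp)).mono fun y hy => hy.differentiableAt (by norm_num)
  have hfirst : fderiv ℝ (fun y => v (A y + c)) =ᶠ[𝓝 x]
      fun y => (fderiv ℝ v (A y + c)).comp (A : E →L[ℝ] E) := by
    filter_upwards [(hA x).continuousAt.eventually hdiff] with y hy
    exact (hy.hasFDerivAt.comp y (hA y)).fderiv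
  have hfderiv : DifferentiableAt ℝ (fderiv ℝ v) (A x + c) :=
    (hv.fderiv_right (m := 1) (by norm_num)).differentiableAt (by norm_num)
  have hsecond := ((hfderiv.hasFDerivAt.comp x (hA x)).clm_comp
    (hasFDerivAt_const (A : E →L[ℝ] E) x)).fderiv
  simp only [Function.comp_def] at hsecond
  rw [laplacian_eq_sum_fderiv_fderiv (stdOrthonormalBasis ℝ E),
    laplacian_eq_sum_fderiv_fderiv ((stdOrthonormalBasis ℝ E).map A), hfirst.fderiv_eq, hsecond]
  simp

end Calculus

section MaximumPrinciple

open Laplacian Metric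

theorem closure_diff_closedBall_subset {X : Type*} [PseudoMetricSpace X] (D : Set X) (p : X)
    (r : ℝ) : closure (D \ closedBall p r) ⊆ closure D \ ball p r :=
  closure_minimal (fun _ hx => ⟨subset_closure hx.1, fun h => hx.2 (ball_subset_closedBall h)⟩)
    (isClosed_closure.sdiff isOpen_ball)

theorem frontier_diff_closedBall_subset {X : Type*} [PseudoMetricSpace X] (D : Set X) (p : X)
    (r : ℝ) : frontier (D \ closedBall p r) ⊆ frontier D ∪ sphere p r := by
  rw [sdiff_eq]
  refine (frontier_inter_subset _ _).trans (union_subset_union inter_subset_left ?_)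
  rw [frontier_compl]
  exact inter_subset_right.trans frontier_closedBall_subset_sphere

variable {E : Type*} [NormedAddCommGroup E]

theorem norm_sub_sq_pos {x p : E} (hx : x ≠ p) : 0 < ‖x - p‖ ^ 2 :=
  pow_pos (norm_pos_iff.2 (sub_ne_zero.2 hx)) 2

/-- The barrier `log (R² / ‖x - p‖²) + R² - ‖x - p‖²`, which tends to infinity at `p` and, in
dimension at least two, is strictly superharmonic elsewhere. -/
noncomputable def singularBarrier (p : E) (R : ℝ) (x : E) : ℝ :=
  Real.log (R ^ 2) - Real.log (‖x - p‖ ^ 2) + (R ^ 2 - ‖x - p‖ ^ 2)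

theorem singularBarrier_nonneg {p x : E} {R : ℝ} (hx : x ≠ p) (hxR : ‖x - p‖ ≤ R) :
    0 ≤ singularBarrier p R x := by
  have hsq : ‖x - p‖ ^ 2 ≤ R ^ 2 := by gcongr
  have hlog := Real.log_le_log (norm_sub_sq_pos hx) hsq
  simp only [singularBarrier]
  linarith

theorem tendsto_singularBarrier (p : E) (R : ℝ) :
    Tendsto (singularBarrier p R) (𝓝[≠] p) atTop := by
  have hsq : Tendsto (fun x => ‖x - p‖ ^ 2) (𝓝[≠] p) (𝓝[>] 0) := by
    refine tendsto_nhdsWithin_iff.2 ⟨?_, eventually_mem_nhdsWithin.mono fun x => norm_sub_sq_pos⟩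
    have hcont : Continuous fun x : E => ‖x - p‖ ^ 2 := by fun_prop
    simpa using (hcont.tendsto p).mono_left nhdsWithin_le_nhds
  have hlog : Tendsto (fun x => Real.log (R ^ 2) - Real.log (‖x - p‖ ^ 2)) (𝓝[≠] p) atTop :=
    tendsto_atTop_add_const_left _ _
      (tendsto_neg_atBot_atTop.comp (Real.tendsto_log_nhdsGT_zero.comp hsq))
  exact hlog.atTop_add (tendsto_const_nhds.sub (tendsto_nhds_of_tendsto_nhdsWithin hsq))

theorem exists_nonneg_add_mul_singularBarrier {S : Set E} {p : E} {w : E → ℝ}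
    (hbelow : BddBelow (w '' S)) (R : ℝ) {η : ℝ} (hη : 0 < η) :
    ∃ r > 0, ∀ x ∈ S, x ≠ p → ‖x - p‖ ≤ r → 0 ≤ w x + η * singularBarrier p R x := by
  obtain ⟨M, hM⟩ := hbelow
  have hev : ∀ᶠ x in 𝓝 p, x ≠ p → -M / η < singularBarrier p R x :=
    eventually_nhdsWithin_iff.1 ((tendsto_singularBarrier p R).eventually_gt_atTop _)
  obtain ⟨r, hr, hball⟩ := nhds_basis_closedBall.eventually_iff.1 hev
  refine ⟨r, hr, fun x hxS hxp hxr => ?_⟩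
  have hH : -M < singularBarrier p R x * η :=
    (div_lt_iff₀ hη).1 (hball (by simpa [dist_eq_norm] using hxr) hxp)
  have hMw : M ≤ w x := hM (mem_image_of_mem w hxS)
  linarith

variable [InnerProductSpace ℝ E]

theorem contDiffAt_singularBarrier {p x : E} (hx : x ≠ p) (R : ℝ) :
    ContDiffAt ℝ 2 (singularBarrier p R) x := by
  refine contDiffAt_comp_norm_sub_sq (g := fun t => Real.log (R ^ 2) - Real.log t + (R ^ 2 - t)) ?_
  have hlog : ContDiffAt ℝ 2 Real.log (‖x - p‖ ^ 2) :=
    Real.contDiffAt_log.2 (norm_sub_sq_pos hx).ne'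
  exact (contDiffAt_const.sub hlog).add (contDiffAt_const.sub contDiffAt_id)

/-- The barrier `‖x - a‖^(-2N) - R^(-2N)` with `N = dim E + 1`. It vanishes on the sphere of radius
`R`, and `N` is so large that it is strictly subharmonic off `a`. -/
noncomputable def annulusBarrier (a : E) (R : ℝ) (x : E) : ℝ :=
  (‖x - a‖ ^ 2) ^ (-(Module.finrank ℝ E + 1 : ℝ)) - (R ^ 2) ^ (-(Module.finrank ℝ E + 1 : ℝ))

theorem contDiffAt_annulusBarrier {a x : E} (hx : x ≠ a) (R : ℝ) :
    ContDiffAt ℝ 2 (annulusBarrier a R) x :=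
  contDiffAt_comp_norm_sub_sq (g := fun t : ℝ =>
    t ^ (-(Module.finrank ℝ E + 1 : ℝ)) - (R ^ 2) ^ (-(Module.finrank ℝ E + 1 : ℝ)))
    ((Real.contDiffAt_rpow_const_of_ne (norm_sub_sq_pos hx).ne').sub contDiffAt_const)

theorem annulusBarrier_pos {a x : E} {R : ℝ} (hx : x ≠ a) (hxR : ‖x - a‖ < R) :
    0 < annulusBarrier a R x := by
  have hlt : ‖x - a‖ ^ 2 < R ^ 2 := by gcongr
  exact sub_pos.2 (Real.rpow_lt_rpow_of_neg (norm_sub_sq_pos hx) hlt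
    (neg_neg_of_pos (by positivity)))

theorem annulusBarrier_le (a : E) {ρ : ℝ} (R : ℝ) {x : E} (hx : ‖x - a‖ = ρ) :
    annulusBarrier a R x ≤ (ρ ^ 2) ^ (-(Module.finrank ℝ E + 1 : ℝ)) := by
  rw [annulusBarrier, hx]
  exact sub_le_self _ (by positivity)

variable [FiniteDimensional ℝ E]

theorem laplacian_singularBarrier_neg (hd : 2 ≤ Module.finrank ℝ E) {p x : E} (hx : x ≠ p)
    (R : ℝ) : Δ (singularBarrier p R) x < 0 := by
  have ht := norm_sub_sq_pos hx
  have hg : ∀ t : ℝ, 0 < t → HasDerivAt (fun t => Real.log (R ^ 2) - Real.log t + (R ^ 2 - t))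
      (-t⁻¹ - 1) t := fun t ht =>
    ((Real.hasDerivAt_log ht.ne').const_sub _).add ((hasDerivAt_id t).const_sub _)
  have hg₁ : ∀ t : ℝ, 0 < t → HasDerivAt (fun t : ℝ => -t⁻¹ - 1) (t ^ 2)⁻¹ t := fun t ht => by
    simpa using (hasDerivAt_inv ht.ne').neg.sub_const 1
  have hΔ : Δ (singularBarrier p R) x = (4 - 2 * Module.finrank ℝ E) * (‖x - p‖ ^ 2)⁻¹
      - 2 * Module.finrank ℝ E := by
    refine (laplacian_comp_norm_sub_sq ((lt_mem_nhds ht).mono hg) (hg₁ _ ht)).trans ?_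
    field_simp
    ring
  have hd' : (2 : ℝ) ≤ Module.finrank ℝ E := by exact_mod_cast hd
  have hmul : (4 - 2 * Module.finrank ℝ E : ℝ) * (‖x - p‖ ^ 2)⁻¹ ≤ 0 :=
    mul_nonpos_of_nonpos_of_nonneg (by linarith) (inv_nonneg.2 ht.le)
  linarith

theorem laplacian_annulusBarrier_pos {a x : E} (hx : x ≠ a) (R : ℝ) :
    0 < Δ (annulusBarrier a R) x := by
  have ht := norm_sub_sq_pos hx
  set N : ℝ := Module.finrank ℝ E + 1
  have hg : ∀ t : ℝ, 0 < t → HasDerivAt (fun t => t ^ (-N) - (R ^ 2) ^ (-N))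
      (-N * t ^ (-N - 1)) t := fun t ht =>
    (Real.hasDerivAt_rpow_const (Or.inl ht.ne')).sub_const _
  have hg₁ : ∀ t : ℝ, 0 < t → HasDerivAt (fun t : ℝ => -N * t ^ (-N - 1))
      (-N * ((-N - 1) * t ^ (-N - 1 - 1))) t := fun t ht =>
    (Real.hasDerivAt_rpow_const (Or.inl ht.ne')).const_mul _
  have hΔ : Δ (annulusBarrier a R) x
      = 2 * N * (2 * N + 2 - Module.finrank ℝ E) * (‖x - a‖ ^ 2) ^ (-N - 1) := by
    refine (laplacian_comp_norm_sub_sq ((lt_mem_nhds ht).mono hg) (hg₁ _ ht)).trans ?_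
    rw [Real.rpow_sub_one ht.ne']
    field_simp [(norm_pos_iff.2 (sub_ne_zero.2 hx)).ne']
    ring
  have hcoef : 0 < 2 * N + 2 - Module.finrank ℝ E := by
    linarith [(Nat.cast_nonneg (Module.finrank ℝ E) : (0 : ℝ) ≤ _)]
  have : 0 < N := by positivity
  rw [hΔ]
  positivity

theorem nonneg_of_laplacian_neg {D : Set E} (hb : Bornology.IsBounded D) {z : E → ℝ}
    (hz : ∀ x ∈ D, ContDiffAt ℝ 2 z x) (hΔ : ∀ x ∈ D, Δ z x < 0)
    (hcont : ContinuousOn z (closure D)) (hbd : ∀ y ∈ frontier D, 0 ≤ z y) :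
    ∀ x ∈ D, 0 ≤ z x := by
  intro x hx
  obtain ⟨y, hy, hmin⟩ := hb.isCompact_closure.exists_isMinOn ⟨x, subset_closure hx⟩ hcont
  refine le_trans ?_ (hmin (subset_closure hx))
  by_contra! hneg
  have hyD : y ∈ interior D := by
    by_contra hn
    exact hneg.not_ge (hbd y ⟨hy, hn⟩)
  have hloc : IsLocalMin z y := by
    filter_upwards [mem_interior_iff_mem_nhds.1 hyD] with a ha using hmin (subset_closure ha)
  have hyD' := interior_subset hyD
  exact (hΔ y hyD').not_ge (laplacian_nonneg_of_isLocalMin (hz y hyD') hloc)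

theorem nonneg_add_mul_singularBarrier (hd : 2 ≤ Module.finrank ℝ E) {D : Set E} (hD : IsOpen D)
    (hb : Bornology.IsBounded D) {p : E} {w : E → ℝ}
    (hw : ∀ x ∈ D \ {p}, ContDiffAt ℝ 2 w x) (hΔ : ∀ x ∈ D \ {p}, Δ w x ≤ 0)
    (hbelow : BddBelow (w '' (D \ {p}))) (hcont : ContinuousOn w (closure D \ {p}))
    (hbd : ∀ y ∈ frontier D, y ≠ p → 0 ≤ w y) {R : ℝ} (hR : closure D ⊆ closedBall p R) {η : ℝ}
    (hη : 0 < η) : ∀ x ∈ D \ {p}, 0 ≤ w x + η * singularBarrier p R x := by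
  set H := singularBarrier p R
  obtain ⟨r, hr, hnear⟩ := exists_nonneg_add_mul_singularBarrier (p := p) hbelow R hη
  intro x hx
  by_cases hxr : ‖x - p‖ ≤ r
  · exact hnear x hx hx.2 hxr
  have hcl := closure_diff_closedBall_subset D p r
  have hne : ∀ y ∈ closure (D \ closedBall p r), y ≠ p := fun y hy h =>
    (hcl hy).2 (h ▸ mem_ball_self hr)
  have hDp : ∀ y ∈ D \ closedBall p r, y ∈ D \ {p} := fun y hy => ⟨hy.1, hne y (subset_closure hy)⟩
  refine nonneg_of_laplacian_neg (D := D \ closedBall p r) (z := fun x => w x + η * H x)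
    (hb.subset sdiff_subset)
    (fun y hy => (hw y (hDp y hy)).add
      (contDiffAt_const.mul (contDiffAt_singularBarrier (hDp y hy).2 R)))
    (fun y hy => ?_) (fun y hy => ?_) (fun y hy => ?_) x
    ⟨hx.1, by simpa [dist_eq_norm] using hxr⟩
  · rw [laplacian_add_const_mul η (hw y (hDp y hy)) (contDiffAt_singularBarrier (hDp y hy).2 R)]
    have := mul_neg_of_pos_of_neg hη (laplacian_singularBarrier_neg hd (hDp y hy).2 R)
    linarith [hΔ y (hDp y hy)]
  · have hyp := hne y hy
    have hwy := (hcont y ⟨(hcl hy).1, hyp⟩).mono fun z hz => ⟨(hcl hz).1, hne z hz⟩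
    exact hwy.add (continuousWithinAt_const.mul
      (contDiffAt_singularBarrier hyp R).continuousAt.continuousWithinAt)
  · have hyp := hne y (frontier_subset_closure hy)
    have hyD := (hcl (frontier_subset_closure hy)).1
    rcases frontier_diff_closedBall_subset D p r hy with hyf | hys
    · exact add_nonneg (hbd y hyf hyp) (mul_nonneg hη.le
        (singularBarrier_nonneg hyp (by simpa [dist_eq_norm] using hR hyD)))
    · by_cases hyD' : y ∈ D
      · exact hnear y ⟨hyD', hyp⟩ hyp (by simpa [dist_eq_norm] using hys.le)
      · exact add_nonneg (hbd y ⟨hyD, by rwa [hD.interior_eq]⟩ hyp) (mul_nonneg hη.le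
          (singularBarrier_nonneg hyp (by simpa [dist_eq_norm] using hR hyD)))

theorem nonneg_of_superharmonic (hd : 2 ≤ Module.finrank ℝ E) {D : Set E} (hD : IsOpen D)
    (hb : Bornology.IsBounded D) (p : E) {w : E → ℝ}
    (hw : ∀ x ∈ D \ {p}, ContDiffAt ℝ 2 w x) (hΔ : ∀ x ∈ D \ {p}, Δ w x ≤ 0)
    (hbelow : BddBelow (w '' (D \ {p}))) (hcont : ContinuousOn w (closure D \ {p}))
    (hbd : ∀ y ∈ frontier D, y ≠ p → 0 ≤ w y) : ∀ x ∈ D \ {p}, 0 ≤ w x := by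
  obtain ⟨R, hR⟩ := hb.closure.subset_closedBall p
  intro x hx
  have hlim : Tendsto (fun η => w x + η * singularBarrier p R x) (𝓝[>] 0)
      (𝓝 (w x + 0 * singularBarrier p R x)) :=
    (Continuous.tendsto (by fun_prop) 0).mono_left nhdsWithin_le_nhds
  simpa using ge_of_tendsto hlim (eventually_mem_nhdsWithin.mono fun η hη =>
    nonneg_add_mul_singularBarrier hd hD hb hw hΔ hbelow hcont hbd hR hη x hx)

theorem pos_of_superharmonic_annulus {a : E} {ρ R c : ℝ} (hρ : 0 < ρ) (hc : 0 < c) {w : E → ℝ}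
    (hw : ∀ x ∈ closedBall a R \ ball a ρ, ContDiffAt ℝ 2 w x)
    (hΔ : ∀ x ∈ closedBall a R \ ball a ρ, Δ w x ≤ 0) (hin : ∀ x ∈ sphere a ρ, c ≤ w x)
    (hout : ∀ x ∈ sphere a R, 0 ≤ w x) : ∀ x ∈ ball a R \ closedBall a ρ, 0 < w x := by
  set D := ball a R \ closedBall a ρ
  set δ : ℝ := c / (ρ ^ 2) ^ (-(Module.finrank ℝ E + 1 : ℝ)) with hδdef
  have hδ : 0 < δ := by positivity
  have hcl : closure D ⊆ closedBall a R \ ball a ρ := (closure_diff_closedBall_subset _ _ _).trans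
    (sdiff_subset_sdiff_left closure_ball_subset_closedBall)
  have hne : ∀ y ∈ closure D, y ≠ a := fun y hy h => (hcl hy).2 (h ▸ mem_ball_self hρ)
  have hz : ∀ y ∈ closure D, ContDiffAt ℝ 2 (fun y => w y + -δ * annulusBarrier a R y) y :=
    fun y hy => (hw y (hcl hy)).add
      (contDiffAt_const.mul (contDiffAt_annulusBarrier (hne y hy) R))
  have hnonneg := nonneg_of_laplacian_neg (isBounded_ball.subset sdiff_subset)
    (fun y hy => hz y (subset_closure hy))
    (fun y hy => by
      have hy' := subset_closure hy
      rw [laplacian_add_const_mul _ (hw y (hcl hy')) (contDiffAt_annulusBarrier (hne y hy') R)]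
      have := mul_pos hδ (laplacian_annulusBarrier_pos (hne y hy') R)
      linarith [hΔ y (hcl hy')])
    (fun y hy => (hz y hy).continuousAt.continuousWithinAt)
    (fun y hy => by
      rcases frontier_diff_closedBall_subset _ a ρ hy with hyR | hyρ
      · have hyR := frontier_ball_subset_sphere hyR
        have hb : annulusBarrier a R y = 0 := by
          rw [annulusBarrier, ← dist_eq_norm, mem_sphere.1 hyR, sub_self]
        simpa [hb] using hout y hyR
      · have hb := mul_le_mul_of_nonneg_left
          (annulusBarrier_le a R (mem_sphere_iff_norm.1 hyρ)) hδ.le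
        rw [hδdef, div_mul_cancel₀ _ (by positivity)] at hb
        linarith [hin y hyρ])
  intro x hx
  have hb := annulusBarrier_pos (hne x (subset_closure hx)) (mem_ball_iff_norm.1 hx.1)
  linarith [hnonneg x hx, mul_pos hδ hb]

theorem pos_of_superharmonic_ball {a : E} {R : ℝ} {w : E → ℝ}
    (hw : ∀ x ∈ closedBall a R, ContDiffAt ℝ 2 w x) (hΔ : ∀ x ∈ closedBall a R, Δ w x ≤ 0)
    (h0 : ∀ x ∈ closedBall a R, 0 ≤ w x) (ha : 0 < w a) : ∀ x ∈ ball a R, 0 < w x := by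
  intro x hx
  have hR : 0 < R := pos_of_mem_ball hx
  have hcont : ContinuousAt w a := (hw a (mem_closedBall_self hR.le)).continuousAt
  obtain ⟨r, hr, hrw⟩ := eventually_nhds_iff_ball.1
    (hcont.eventually (lt_mem_nhds (half_lt_self ha)))
  by_cases hxr : x ∈ ball a r
  · exact (half_pos ha).trans (hrw x hxr)
  have hρr : r / 2 < r := half_lt_self hr
  exact pos_of_superharmonic_annulus (half_pos hr) (half_pos ha) (fun y hy => hw y hy.1)
    (fun y hy => hΔ y hy.1) (fun y hy => (hrw y (sphere_subset_ball hρr hy)).le)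
    (fun y hy => h0 y (sphere_subset_closedBall hy)) x
    ⟨hx, fun h => hxr (closedBall_subset_ball hρr h)⟩

theorem closure_pos_inter_subset {U : Set E} (hU : IsOpen U) {w : E → ℝ}
    (hw : ∀ x ∈ U, ContDiffAt ℝ 2 w x) (hΔ : ∀ x ∈ U, Δ w x ≤ 0) (h0 : ∀ x ∈ U, 0 ≤ w x) :
    closure {x ∈ U | 0 < w x} ∩ U ⊆ {x ∈ U | 0 < w x} := by
  rintro x ⟨hxc, hxU⟩
  obtain ⟨r, hr, hrU⟩ := isOpen_iff.1 hU x hxU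
  obtain ⟨a, ha, hxa⟩ := mem_closure_iff.1 hxc (r / 3) (by positivity)
  have hsub : closedBall a (r / 3) ⊆ U := (closedBall_subset_ball' (by
    rw [dist_comm] at hxa
    linarith)).trans hrU
  exact ⟨hxU, pos_of_superharmonic_ball (fun y hy => hw y (hsub hy)) (fun y hy => hΔ y (hsub hy))
    (fun y hy => h0 y (hsub hy)) ha.2 x hxa⟩

theorem pos_of_superharmonic {U S : Set E} (hU : IsOpen U) {w : E → ℝ}
    (hw : ∀ x ∈ U, ContDiffAt ℝ 2 w x) (hΔ : ∀ x ∈ U, Δ w x ≤ 0) (h0 : ∀ x ∈ U, 0 ≤ w x)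
    (hS : IsPreconnected S) (hSU : S ⊆ U) {y : E} (hy : y ∈ S) (hwy : 0 < w y) :
    ∀ x ∈ S, 0 < w x := by
  have hopen : IsOpen {x ∈ U | 0 < w x} :=
    ContinuousOn.isOpen_inter_preimage (fun x hx => (hw x hx).continuousAt.continuousWithinAt)
      hU isOpen_Ioi
  have hsub := hS.subset_of_closure_inter_subset hopen ⟨y, hy, hSU hy, hwy⟩
    fun x hx => closure_pos_inter_subset hU hw hΔ h0 ⟨hx.1, hSU hx.2⟩
  exact fun x hx => (hsub hx).2

end MaximumPrinciple

section Potential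

open Laplacian MeasureTheory Metric Module

section RpowIntegral

variable (p : ℝ) {T t : ℝ}

theorem intervalIntegrable_rpow_of_pos (ht : 0 < t) (hT : 0 < T) :
    IntervalIntegrable (fun s : ℝ => s ^ p) volume t T :=
  intervalIntegral.intervalIntegrable_rpow (Or.inr (notMem_uIcc_of_lt ht hT))

theorem hasDerivAt_integral_rpow_left (hT : 0 < T) (ht : 0 < t) :
    HasDerivAt (fun t => ∫ s in t..T, s ^ p) (-t ^ p) t := by
  have hc : ContinuousOn (fun s : ℝ => s ^ p) (Ioi 0) := fun s hs =>
    (Real.continuousAt_rpow_const s p (Or.inl (ne_of_gt hs))).continuousWithinAt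
  exact intervalIntegral.integral_hasDerivAt_left (intervalIntegrable_rpow_of_pos p ht hT)
    (hc.stronglyMeasurableAtFilter isOpen_Ioi t ht) (hc.continuousAt (Ioi_mem_nhds ht))

theorem contDiffAt_integral_rpow_left (hT : 0 < T) (ht : 0 < t) :
    ContDiffAt ℝ 2 (fun t => ∫ s in t..T, s ^ p) t := by
  have h : ContDiffOn ℝ (1 + 1) (fun t => ∫ s in t..T, s ^ p) (Ioi 0) := by
    rw [contDiffOn_succ_iff_deriv_of_isOpen isOpen_Ioi]
    refine ⟨fun s hs =>
      (hasDerivAt_integral_rpow_left p hT hs).differentiableAt.differentiableWithinAt, by simp, ?_⟩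
    have hderiv : ContDiffOn ℝ 1 (fun s : ℝ => -s ^ p) (Ioi 0) := fun s hs =>
      (Real.contDiffAt_rpow_const_of_ne (ne_of_gt hs)).neg.contDiffWithinAt
    exact hderiv.congr fun s hs => (hasDerivAt_integral_rpow_left p hT hs).deriv
  exact h.contDiffAt (Ioi_mem_nhds ht)

theorem integral_rpow_nonneg (ht : 0 < t) (htT : t ≤ T) : 0 ≤ ∫ s in t..T, s ^ p :=
  intervalIntegral.integral_nonneg htT fun _ hs => Real.rpow_nonneg (ht.le.trans hs.1) _

theorem integral_rpow_anti_left {s : ℝ} (hs : 0 < s) (hst : s ≤ t) (htT : t ≤ T) :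
    ∫ r in t..T, r ^ p ≤ ∫ r in s..T, r ^ p := by
  have ht := hs.trans_le hst
  rw [← intervalIntegral.integral_add_adjacent_intervals
    (intervalIntegrable_rpow_of_pos p hs ht)
    (intervalIntegrable_rpow_of_pos p ht (ht.trans_le htT))]
  linarith [integral_rpow_nonneg p hs hst]

variable {p}

theorem integral_rpow_le_mul_rpow (hp : p ≤ -(1 / 2)) (ht : 0 < t) (htT : t ≤ T) :
    ∫ s in t..T, s ^ p ≤ 2 * Real.sqrt T * t ^ (p + 1 / 2) := by
  have hT := ht.trans_le htT
  have hpointwise : ∀ s ∈ Icc t T, s ^ p ≤ t ^ (p + 1 / 2) * s ^ (-(1 / 2) : ℝ) := fun s hs => by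
    have hs0 := ht.trans_le hs.1
    calc s ^ p = s ^ (p + 1 / 2) * s ^ (-(1 / 2) : ℝ) := by
          rw [← Real.rpow_add hs0]
          ring_nf
      _ ≤ t ^ (p + 1 / 2) * s ^ (-(1 / 2) : ℝ) := by
          gcongr ?_ * _
          exact Real.rpow_le_rpow_of_nonpos ht hs.1 (by linarith)
  calc ∫ s in t..T, s ^ p ≤ ∫ s in t..T, t ^ (p + 1 / 2) * s ^ (-(1 / 2) : ℝ) :=
        intervalIntegral.integral_mono_on htT (intervalIntegrable_rpow_of_pos p ht hT)
          ((intervalIntegrable_rpow_of_pos _ ht hT).const_mul _) hpointwise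
    _ = 2 * (Real.sqrt T - Real.sqrt t) * t ^ (p + 1 / 2) := by
        rw [intervalIntegral.integral_const_mul, integral_rpow (Or.inl (by norm_num)),
          show (-(1 / 2) + 1 : ℝ) = 1 / 2 by norm_num, ← Real.sqrt_eq_rpow, ← Real.sqrt_eq_rpow]
        ring
    _ ≤ 2 * Real.sqrt T * t ^ (p + 1 / 2) := by
        gcongr
        exact sub_le_self _ (Real.sqrt_nonneg t)

end RpowIntegral

theorem exists_finset_pairwiseDisjoint_ball {X : Type*} [PseudoMetricSpace X] {D : Set X}
    (hD : TotallyBounded D) {η : ℝ} (hη : 0 < η) :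
    ∃ F : Finset X, ↑F ⊆ D ∧ (F : Set X).PairwiseDisjoint (fun y => ball y (η / 2)) ∧
      ∀ x ∈ D, ∃ y ∈ F, dist x y ≤ η := by
  lift η to ℝ≥0 using hη.le
  have hpack : packingNumber η D ≠ ⊤ := by
    obtain ⟨N, -, hN, hcover⟩ := exists_finite_isCover_of_totallyBounded
      (ε := η / 2) (by simpa using hη.ne') hD
    have hle := (packingNumber_two_mul_le_externalCoveringNumber (η / 2) D).trans
      hcover.externalCoveringNumber_le_encard
    rw [mul_div_cancel₀ η two_ne_zero] at hle
    exact (hle.trans_lt hN.encard_lt_top).ne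
  have hfin : (maximalSeparatedSet η D).Finite := by
    rwa [← encard_ne_top_iff, encard_maximalSeparatedSet hpack]
  refine ⟨hfin.toFinset, by simpa using maximalSeparatedSet_subset, ?_, fun x hx => ?_⟩
  · intro y hy z hz hyz
    have hsep : (η : ENNReal) < edist y z := isSeparated_maximalSeparatedSet
      (hfin.mem_toFinset.1 hy) (hfin.mem_toFinset.1 hz) hyz
    rw [edist_nndist, ENNReal.coe_lt_coe, ← NNReal.coe_lt_coe, coe_nndist] at hsep
    exact ball_disjoint_ball (by linarith)
  · obtain ⟨y, hy, hxy⟩ := isCover_maximalSeparatedSet hpack hx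
    have hdist : edist x y ≤ η := hxy
    rw [edist_nndist, ENNReal.coe_le_coe, ← NNReal.coe_le_coe, coe_nndist] at hdist
    exact ⟨y, hfin.mem_toFinset.2 hy, hdist⟩

theorem exists_le_one_ball_half_subset {X : Type*} [PseudoMetricSpace X] {D U : Set X}
    (hD : IsCompact D) (hU : IsOpen U) (hDU : D ⊆ U) :
    ∃ η > 0, η ≤ 1 ∧ ∀ y ∈ D, ball y (η / 2) ⊆ U := by
  obtain ⟨η, hη, hηU⟩ := hD.exists_thickening_subset_open hU hDU
  refine ⟨min η 1, by positivity, min_le_right _ _, fun y hy => ?_⟩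
  have hle : min η 1 / 2 ≤ η := (half_le_self (by positivity)).trans (min_le_left _ _)
  exact ((ball_subset_ball hle).trans (ball_subset_thickening hy η)).trans hηU

variable {E : Type*} [NormedAddCommGroup E] {R η : ℝ} {x y z : E}

theorem norm_sub_sq_add_sq_le (hη : 0 ≤ η) (hη1 : η ≤ 1) (hx : ‖x - y‖ ≤ R) :
    ‖x - y‖ ^ 2 + η ^ 2 ≤ R ^ 2 + 1 := by
  have hsq : ‖x - y‖ ^ 2 ≤ R ^ 2 := by gcongr
  linarith [pow_le_one₀ hη hη1 (n := 2)]

variable [InnerProductSpace ℝ E]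

/-- A fundamental solution of `-Δ` with pole `y`, smoothed out at scale `η`, up to a constant
factor. The additive constant, encoded in the upper limit, makes it nonnegative on the ball of
radius `R` about `y` when `η ≤ 1`. -/
noncomputable def regularizedKernel (R η : ℝ) (y x : E) : ℝ :=
  ∫ s in (‖x - y‖ ^ 2 + η ^ 2)..(R ^ 2 + 1), s ^ (-(finrank ℝ E / 2) : ℝ)

theorem contDiffAt_regularizedKernel (R : ℝ) (hη : 0 < η) (y x : E) :
    ContDiffAt ℝ 2 (regularizedKernel R η y) x := by
  refine contDiffAt_comp_norm_sub_sq
    (g := fun t => ∫ s in (t + η ^ 2)..(R ^ 2 + 1), s ^ (-(finrank ℝ E / 2) : ℝ)) ?_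
  exact ContDiffAt.comp (‖x - y‖ ^ 2)
    (contDiffAt_integral_rpow_left _ (by positivity) (by positivity))
    (contDiffAt_id.add contDiffAt_const)

theorem regularizedKernel_nonneg (hη : 0 < η) (hη1 : η ≤ 1) (hx : ‖x - y‖ ≤ R) :
    0 ≤ regularizedKernel R η y x :=
  integral_rpow_nonneg _ (by positivity) (norm_sub_sq_add_sq_le hη.le hη1 hx)

variable (E) in
/-- The constant for which `regularizedKernel R η y x ≤ C * ‖x - z‖ ^ (1 - dim E)` when `z` is
`η`-close to the pole `y`. -/
noncomputable def regularizedKernelConst (R : ℝ) : ℝ :=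
  2 * Real.sqrt (R ^ 2 + 1) * (2⁻¹ : ℝ) ^ (-(finrank ℝ E / 2) + 1 / 2 : ℝ)

variable (E) in
/-- The constant for which `Δ (regularizedKernel R η y) ≤ -C / η ^ dim E` on the ball of radius `η`
about the pole `y`. -/
noncomputable def coverConst : ℝ :=
  finrank ℝ E * 2 ^ (-(finrank ℝ E / 2) : ℝ)

/-- The sum of the kernels with poles in `F`, scaled so that its Laplacian is at most `-1` on the
`η`-neighbourhood of `F`. -/
noncomputable def discretePotential (R η : ℝ) (F : Finset E) (x : E) : ℝ :=
  η ^ finrank ℝ E / coverConst E * ∑ y ∈ F, regularizedKernel R η y x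

theorem contDiffAt_discretePotential (R : ℝ) (hη : 0 < η) (F : Finset E) (x : E) :
    ContDiffAt ℝ 2 (discretePotential R η F) x :=
  contDiffAt_const.mul (ContDiffAt.sum fun y _ => contDiffAt_regularizedKernel R hη y x)

variable [FiniteDimensional ℝ E]

theorem laplacian_regularizedKernel (R : ℝ) (hη : 0 < η) (y x : E) :
    Δ (regularizedKernel R η y) x = -(2 * finrank ℝ E * η ^ 2 *
      (‖x - y‖ ^ 2 + η ^ 2) ^ (-(finrank ℝ E / 2) - 1 : ℝ)) := by
  have hT : 0 < R ^ 2 + 1 := by positivity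
  have ht : 0 < ‖x - y‖ ^ 2 + η ^ 2 := by positivity
  set p : ℝ := -(finrank ℝ E / 2) with hp
  have hg : ∀ᶠ t in 𝓝 (‖x - y‖ ^ 2),
      HasDerivAt (fun t => ∫ s in (t + η ^ 2)..(R ^ 2 + 1), s ^ p) (-(t + η ^ 2) ^ p) t := by
    filter_upwards [lt_mem_nhds (show -η ^ 2 < ‖x - y‖ ^ 2 by linarith)] with t ht
    exact (hasDerivAt_integral_rpow_left p hT (by linarith)).comp_add_const t (η ^ 2)
  have hg₁ : HasDerivAt (fun t => -(t + η ^ 2) ^ p)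
      (-(p * (‖x - y‖ ^ 2 + η ^ 2) ^ (p - 1))) (‖x - y‖ ^ 2) :=
    ((Real.hasDerivAt_rpow_const (Or.inl ht.ne')).comp_add_const _ (η ^ 2)).neg
  refine (laplacian_comp_norm_sub_sq hg hg₁).trans ?_
  rw [show (finrank ℝ E : ℝ) = -2 * p by rw [hp]; ring, Real.rpow_sub_one ht.ne']
  field_simp
  ring

theorem laplacian_regularizedKernel_nonpos (R : ℝ) (hη : 0 < η) (y x : E) :
    Δ (regularizedKernel R η y) x ≤ 0 := by
  rw [laplacian_regularizedKernel R hη, neg_nonpos]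
  positivity

theorem laplacian_regularizedKernel_le (R : ℝ) (hη : 0 < η) (hx : ‖x - y‖ ≤ η) :
    Δ (regularizedKernel R η y) x ≤
      -(coverConst E / η ^ finrank ℝ E) := by
  rw [laplacian_regularizedKernel R hη, neg_le_neg_iff, coverConst]
  set d := finrank ℝ E
  have hle : ‖x - y‖ ^ 2 + η ^ 2 ≤ 2 * η ^ 2 := by
    have : ‖x - y‖ ^ 2 ≤ η ^ 2 := by gcongr
    linarith
  have hpow : (η ^ 2) ^ (-(d / 2) : ℝ) = (η ^ d)⁻¹ := by
    rw [← Real.rpow_natCast, ← Real.rpow_natCast, ← Real.rpow_mul hη.le, ← Real.rpow_neg hη.le]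
    push_cast
    ring_nf
  calc d * 2 ^ (-(d / 2) : ℝ) / η ^ d
      = 2 * d * η ^ 2 * (2 * η ^ 2) ^ (-(d / 2) - 1 : ℝ) := by
        rw [Real.rpow_sub_one (by positivity), Real.mul_rpow (by norm_num) (by positivity), hpow]
        field_simp
    _ ≤ 2 * d * η ^ 2 * (‖x - y‖ ^ 2 + η ^ 2) ^ (-(d / 2) - 1 : ℝ) := by
        gcongr ?_ * ?_
        refine Real.rpow_le_rpow_of_nonpos (by positivity) hle ?_
        linarith [show (0 : ℝ) ≤ d / 2 by positivity]

theorem laplacian_discretePotential (R : ℝ) (hη : 0 < η) (F : Finset E) (x : E) :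
    Δ (discretePotential R η F) x
      = η ^ finrank ℝ E / coverConst E * ∑ y ∈ F, Δ (regularizedKernel R η y) x := by
  have hk := fun y (_ : y ∈ F) => contDiffAt_regularizedKernel R hη y x
  exact (laplacian_const_mul _ (ContDiffAt.sum hk)).trans (by rw [laplacian_sum F hk])

theorem laplacian_discretePotential_nonpos (R : ℝ) (hη : 0 < η) (F : Finset E) (x : E) :
    Δ (discretePotential R η F) x ≤ 0 := by
  have hc : 0 ≤ coverConst E := by
    rw [coverConst]
    positivity
  rw [laplacian_discretePotential R hη]
  exact mul_nonpos_of_nonneg_of_nonpos (by positivity)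
    (Finset.sum_nonpos fun y _ => laplacian_regularizedKernel_nonpos R hη y x)

variable [Nontrivial E]

variable (E) in
theorem coverConst_pos : 0 < coverConst E := by
  have : 0 < finrank ℝ E := finrank_pos
  rw [coverConst]
  positivity

theorem laplacian_discretePotential_le_neg_one (R : ℝ) (hη : 0 < η) {F : Finset E} (hy : y ∈ F)
    (hxy : ‖x - y‖ ≤ η) : Δ (discretePotential R η F) x ≤ -1 := by
  have hc := coverConst_pos E
  have hsingle := Finset.single_le_sum (f := fun y : E => -(Δ (regularizedKernel R η y) x))
    (fun y _ => neg_nonneg.2 (laplacian_regularizedKernel_nonpos R hη y x)) hy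
  rw [Finset.sum_neg_distrib, neg_le_neg_iff] at hsingle
  calc Δ (discretePotential R η F) x
      = η ^ finrank ℝ E / coverConst E * ∑ y ∈ F, Δ (regularizedKernel R η y) x :=
        laplacian_discretePotential R hη F x
    _ ≤ η ^ finrank ℝ E / coverConst E * -(coverConst E / η ^ finrank ℝ E) := by
        gcongr
        exact hsingle.trans (laplacian_regularizedKernel_le R hη hxy)
    _ = -1 := by field_simp

theorem regularizedKernel_le (hη : 0 ≤ η) (hη1 : η ≤ 1) (hx : ‖x - y‖ ≤ R) (hz : ‖z - y‖ ≤ η)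
    (hxz : x ≠ z) :
    regularizedKernel R η y x
      ≤ regularizedKernelConst E R * ‖x - z‖ ^ (1 - finrank ℝ E : ℝ) := by
  have hd : (1 : ℝ) ≤ finrank ℝ E := by exact_mod_cast finrank_pos (R := ℝ) (M := E)
  have hpos := norm_pos_iff.2 (sub_ne_zero.2 hxz)
  have htT := norm_sub_sq_add_sq_le hη hη1 hx
  have hle : ‖x - z‖ ^ 2 * 2⁻¹ ≤ ‖x - y‖ ^ 2 + η ^ 2 := by
    have htri : ‖x - z‖ ≤ ‖x - y‖ + η := by
      have := norm_sub_le_norm_sub_add_norm_sub x y z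
      rw [norm_sub_rev y z] at this
      linarith
    have hsq : ‖x - z‖ ^ 2 ≤ (‖x - y‖ + η) ^ 2 := by gcongr
    linarith [add_sq_le (a := ‖x - y‖) (b := η)]
  have hs : 0 < ‖x - z‖ ^ 2 * 2⁻¹ := by positivity
  refine (integral_rpow_anti_left _ hs hle htT).trans ?_
  refine (integral_rpow_le_mul_rpow (by linarith) hs (hle.trans htT)).trans_eq ?_
  rw [regularizedKernelConst, Real.mul_rpow (by positivity) (by norm_num),
    ← Real.rpow_natCast ‖x - z‖, ← Real.rpow_mul hpos.le]
  push_cast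
  ring_nf

variable [MeasurableSpace E] [BorelSpace E]

theorem integrableOn_ball_norm_rpow (C ρ : ℝ) :
    IntegrableOn (fun v : E => C * ‖v‖ ^ (1 - finrank ℝ E : ℝ)) (ball 0 ρ) volume := by
  have hd := finrank_pos (R := ℝ) (M := E)
  rw [integrableOn_fun_norm_addHaar volume (f := fun s => C * s ^ (1 - finrank ℝ E : ℝ))]
  refine (integrableOn_const (C := C) (by simp)).congr_fun (fun s hs => ?_) measurableSet_Ioo
  have hpow : s ^ (finrank ℝ E - 1) * s ^ (1 - finrank ℝ E : ℝ) = 1 := by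
    rw [← Real.rpow_natCast, ← Real.rpow_add hs.1, Nat.cast_sub hd]
    simp
  simp only [smul_eq_mul]
  linear_combination -C * hpow

theorem exists_measure_lt_setLIntegral_norm_rpow_lt (C ρ : ℝ) {ε : ENNReal} (hε : ε ≠ 0) :
    ∃ δ > 0, ∀ U : Set E, MeasurableSet U → volume U < δ → ∀ x : E,
      ∫⁻ z in U ∩ ball x ρ, ENNReal.ofReal (C * ‖x - z‖ ^ (1 - finrank ℝ E : ℝ)) < ε := by
  set h : E → ENNReal := fun v => ENNReal.ofReal (C * ‖v‖ ^ (1 - finrank ℝ E : ℝ))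
  have hmeas : Measurable h :=
    ENNReal.measurable_ofReal.comp (measurable_const.mul (measurable_norm.pow_const _))
  have hfin : ∫⁻ v, h v ∂(volume.restrict (ball 0 ρ)) ≠ ⊤ :=
    (integrableOn_ball_norm_rpow C ρ).lintegral_lt_top.ne
  obtain ⟨δ, hδ, hsmall⟩ := exists_pos_setLIntegral_lt_of_measure_lt hfin hε
  refine ⟨δ, hδ, fun U hU hUδ x => ?_⟩
  have hmp : MeasurePreserving (fun z : E => x - z) volume volume :=
    Measure.measurePreserving_sub_left volume x
  have hs : MeasurableSet ((fun z : E => x - z) ⁻¹' U) := hmp.measurable hU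
  have hlt := hsmall _ ((Measure.restrict_apply_le _ _).trans_lt
    ((hmp.measure_preimage hU.nullMeasurableSet).trans_lt hUδ))
  rw [Measure.restrict_restrict hs,
    ← hmp.setLIntegral_comp_preimage (hs.inter measurableSet_ball) hmeas] at hlt
  convert hlt using 3
  ext z
  simp [dist_eq_norm, norm_sub_rev]

theorem volume_real_mul_regularizedKernel_le (hη : 0 < η) (hη1 : η ≤ 1) (hx : ‖x - y‖ ≤ R) :
    ENNReal.ofReal (volume.real (ball (0 : E) (η / 2)) * regularizedKernel R η y x)
      ≤ ∫⁻ z in ball y (η / 2), ENNReal.ofReal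
        (regularizedKernelConst E R * ‖x - z‖ ^ (1 - finrank ℝ E : ℝ)) := by
  have hae : ∀ᵐ z ∂(volume.restrict (ball y (η / 2))),
      ENNReal.ofReal (regularizedKernel R η y x) ≤ ENNReal.ofReal
        (regularizedKernelConst E R * ‖x - z‖ ^ (1 - finrank ℝ E : ℝ)) := by
    rw [ae_restrict_iff' measurableSet_ball]
    filter_upwards [compl_mem_ae_iff.2 (measure_singleton (μ := (volume : Measure E)) x)]
      with z hzx hzy
    refine ENNReal.ofReal_le_ofReal (regularizedKernel_le hη.le hη1 hx ?_ (Ne.symm hzx))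
    linarith [mem_ball_iff_norm.1 hzy]
  refine le_trans (le_of_eq ?_) (lintegral_mono_ae hae)
  rw [lintegral_const, Measure.restrict_apply_univ, ENNReal.ofReal_mul measureReal_nonneg,
    ofReal_measureReal measure_ball_lt_top.ne, ← Measure.addHaar_ball_center volume y,
    mul_comm]

/-- Each kernel is comparable to its average over a ball of radius `η / 2` about its pole, so the
sum over a separated set of poles in `U` is controlled by an integral over `U`. -/
theorem volume_real_mul_sum_regularizedKernel_le (hη : 0 < η) (hη1 : η ≤ 1) {F : Finset E}
    (hdisj : (F : Set E).PairwiseDisjoint (fun y => ball y (η / 2))) (hx : ∀ y ∈ F, ‖x - y‖ ≤ R)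
    {U : Set E} (hU : ∀ y ∈ F, ball y (η / 2) ⊆ U) {M : ℝ} (hM : 0 ≤ M)
    (hint : ∫⁻ z in U ∩ ball x (R + 1), ENNReal.ofReal
      (regularizedKernelConst E R * ‖x - z‖ ^ (1 - finrank ℝ E : ℝ)) ≤ ENNReal.ofReal M) :
    volume.real (ball (0 : E) (η / 2)) * ∑ y ∈ F, regularizedKernel R η y x ≤ M := by
  have hball : ∀ y ∈ F, ball y (η / 2) ⊆ U ∩ ball x (R + 1) := fun y hy =>
    subset_inter (hU y hy) (ball_subset_ball' (by
      rw [dist_comm, dist_eq_norm]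
      linarith [hx y hy]))
  rw [← ENNReal.ofReal_le_ofReal_iff hM, Finset.mul_sum, ENNReal.ofReal_sum_of_nonneg
    fun y hy => mul_nonneg measureReal_nonneg (regularizedKernel_nonneg hη hη1 (hx y hy))]
  refine (Finset.sum_le_sum fun y hy =>
    volume_real_mul_regularizedKernel_le hη hη1 (hx y hy)).trans ?_
  rw [← lintegral_biUnion_finset hdisj fun y _ => measurableSet_ball]
  exact (lintegral_mono_set (iUnion₂_subset hball)).trans hint

variable (E) in
theorem exists_small_potential {ε : ℝ} (hε : 0 < ε) (R : ℝ) :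
    ∃ δ > 0, ∀ D : Set E, IsCompact D → D ⊆ ball 0 R → volume D < δ →
      ∃ φ : E → ℝ, (∀ x, ContDiffAt ℝ 2 φ x) ∧ (∀ x, Δ φ x ≤ 0) ∧ (∀ x ∈ D, Δ φ x ≤ -1) ∧
        ∀ x ∈ ball 0 R, 0 ≤ φ x ∧ φ x ≤ ε := by
  have hc := coverConst_pos E
  have hω : 0 < volume.real (ball (0 : E) 1) :=
    ENNReal.toReal_pos (measure_ball_pos _ _ one_pos).ne' measure_ball_lt_top.ne
  obtain ⟨δ, hδ, hsmall⟩ := exists_measure_lt_setLIntegral_norm_rpow_lt (E := E)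
    (regularizedKernelConst E (2 * R)) (2 * R + 1)
    (ε := ENNReal.ofReal (ε * volume.real (ball (0 : E) 1) * coverConst E / 2 ^ finrank ℝ E))
    (by simpa using by positivity)
  refine ⟨δ, hδ, fun D hD hDR hDδ => ?_⟩
  obtain ⟨U, hDU, hUo, hUδ⟩ := D.exists_isOpen_lt_of_lt δ hDδ
  obtain ⟨η, hη, hη1, hηU⟩ := exists_le_one_ball_half_subset hD hUo hDU
  obtain ⟨F, hFD, hdisj, hcover⟩ := exists_finset_pairwiseDisjoint_ball hD.totallyBounded hη
  have hxy : ∀ x ∈ ball (0 : E) R, ∀ y ∈ F, ‖x - y‖ ≤ 2 * R := fun x hx y hy => by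
    linarith [norm_sub_le x y, mem_ball_zero_iff.1 hx, mem_ball_zero_iff.1 (hDR (hFD hy))]
  refine ⟨discretePotential (2 * R) η F, fun x => contDiffAt_discretePotential _ hη F x,
    fun x => laplacian_discretePotential_nonpos _ hη F x, fun x hx => ?_, fun x hx => ⟨?_, ?_⟩⟩
  · obtain ⟨y, hy, hdist⟩ := hcover x hx
    exact laplacian_discretePotential_le_neg_one _ hη hy (by rwa [← dist_eq_norm])
  · exact mul_nonneg (by positivity)
      (Finset.sum_nonneg fun y hy => regularizedKernel_nonneg hη hη1 (hxy x hx y hy))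
  · have hsum := volume_real_mul_sum_regularizedKernel_le hη hη1 hdisj (hxy x hx)
      (fun y hy => hηU y (hFD hy)) (by positivity) (hsmall U hUo.measurableSet hUδ x).le
    rw [← Measure.addHaar_real_closedBall_eq_addHaar_real_ball,
      Measure.addHaar_real_closedBall _ _ (by positivity), div_pow] at hsum
    rw [discretePotential]
    field_simp at hsum ⊢
    exact hsum

end Potential

section Reflection

open MeasureTheory

variable {E : Type*} [NormedAddCommGroup E] [InnerProductSpace ℝ E] {e : E} {Ω : Set E} {l : ℝ}
  {x y : E}

theorem inner_add_smul_self (he : ‖e‖ = 1) (x : E) (t : ℝ) :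
    inner ℝ e (x + t • e) = inner ℝ e x + t := by
  rw [inner_add_right, inner_smul_right, real_inner_self_eq_norm_sq, he]
  ring

theorem ne_zero_of_inner_pos (hx : 0 < inner ℝ e x) : x ≠ 0 := by
  rintro rfl
  exact hx.ne' (inner_zero_right e)

theorem add_smul_ne_smul (he : ‖e‖ = 1) (hx : x ≠ (inner ℝ e x : ℝ) • e) (t r : ℝ) :
    x + t • e ≠ r • e := fun h => by
  have hxr : x = 0 + (r - t) • e := by rw [sub_smul, ← h]; abel
  apply hx
  rw [hxr, inner_add_smul_self he, inner_zero_right]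
  module

theorem dense_ne_inner_smul (hd : 2 ≤ Module.finrank ℝ E) (e : E) :
    Dense {x : E | x ≠ (inner ℝ e x : ℝ) • e} := by
  have hspan : (ℝ ∙ e) ≠ ⊤ := fun h => by
    have hle : Module.finrank ℝ (ℝ ∙ e) ≤ ({e} : Set E).toFinset.card := finrank_span_le_card {e}
    rw [h, finrank_top, toFinset_singleton, Finset.card_singleton] at hle
    omega
  have hint : interior ((ℝ ∙ e : Submodule ℝ E) : Set E) = ∅ :=
    not_nonempty_iff_eq_empty.1 fun h => hspan (Submodule.eq_top_of_nonempty_interior' _ h)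
  refine (interior_eq_empty_iff_dense_compl.1 hint).mono
    fun x (hx : x ∉ (ℝ ∙ e)) (h : x = (inner ℝ e x : ℝ) • e) => hx ?_
  rw [h]
  exact Submodule.smul_mem _ _ (Submodule.mem_span_singleton_self e)

/-- The reflection in the hyperplane `⟪e, x⟫ = l`, for a unit vector `e`. -/
noncomputable def planeReflection (e : E) (l : ℝ) (x : E) : E := x + (2 * (l - inner ℝ e x)) • e

theorem planeReflection_zero_right (e : E) (l : ℝ) : planeReflection e l 0 = (2 * l) • e := by
  simp [planeReflection]

theorem planeReflection_of_inner_eq (h : inner ℝ e x = l) : planeReflection e l x = x := by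
  simp [planeReflection, h]

theorem planeReflection_add_smul_self (he : ‖e‖ = 1) (l : ℝ) (x : E) (t : ℝ) :
    planeReflection e l (x + t • e) = x + (2 * (l - inner ℝ e x) - t) • e := by
  rw [planeReflection, inner_add_smul_self he]
  module

theorem inner_planeReflection (he : ‖e‖ = 1) (l : ℝ) (x : E) :
    inner ℝ e (planeReflection e l x) = 2 * l - inner ℝ e x := by
  rw [planeReflection, inner_add_smul_self he]
  ring

theorem planeReflection_planeReflection (he : ‖e‖ = 1) (l : ℝ) (x : E) :
    planeReflection e l (planeReflection e l x) = x := by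
  rw [planeReflection, inner_planeReflection he, planeReflection]
  module

theorem planeReflection_ne_zero (he : ‖e‖ = 1) (hx : x ≠ planeReflection e l 0) :
    planeReflection e l x ≠ 0 := fun h => by
  rw [← h, planeReflection_planeReflection he] at hx
  exact hx rfl

theorem planeReflection_neg (e x : E) : planeReflection (-e) 0 x = planeReflection e 0 x := by
  rw [planeReflection, planeReflection, inner_neg_left]
  module

theorem continuous_planeReflection (e : E) :
    Continuous fun q : ℝ × E => planeReflection e q.1 q.2 := by
  unfold planeReflection
  fun_prop

theorem planeReflection_eq_reflection_add (he : ‖e‖ = 1) (l : ℝ) (x : E) :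
    planeReflection e l x = (ℝ ∙ e)ᗮ.reflection x + (2 * l) • e := by
  rw [Submodule.reflection_orthogonal_apply, Submodule.reflection_singleton_apply, he,
    planeReflection]
  simp only [RCLike.ofReal_real_eq_id, id, one_pow, div_one]
  module

theorem planeReflection_bisector (hxy : ‖x‖ = ‖y‖) (hne : x ≠ y) :
    planeReflection (‖x - y‖⁻¹ • (x - y)) 0 x = y := by
  have hnorm : ‖x - y‖ ≠ 0 := norm_ne_zero_iff.2 (sub_ne_zero.2 hne)
  have hinner : 2 * (inner ℝ (x - y) x : ℝ) = ‖x - y‖ ^ 2 := by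
    rw [norm_sub_sq_real, inner_sub_left, real_inner_self_eq_norm_sq, ← hxy, real_inner_comm]
    ring
  have hcoeff : 2 * (0 - ‖x - y‖⁻¹ * (inner ℝ (x - y) x : ℝ)) * ‖x - y‖⁻¹ = -1 := by
    field_simp
    linarith
  rw [planeReflection, real_inner_smul_left, smul_smul, hcoeff]
  module

/-- An open bounded set which, with each point, contains the points of the line in the direction
`e` through it that are at most as far from the hyperplane `e^⊥`: the coordinate-free form of
convexity in the direction `e` together with symmetry in `e^⊥`. -/
structure IsSteinerDomain (e : E) (Ω : Set E) : Prop where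
  norm_eq : ‖e‖ = 1
  isOpen : IsOpen Ω
  isBounded : Bornology.IsBounded Ω
  slide : ∀ x ∈ Ω, ∀ t : ℝ, |t| ≤ |inner ℝ e x| → x + (t - inner ℝ e x) • e ∈ Ω

/-- The part of `Ω` beyond the hyperplane `⟪e, x⟫ = l`. -/
def cap (e : E) (Ω : Set E) (l : ℝ) : Set E := {x ∈ Ω | l < inner ℝ e x}

/-- The cap without the mirror image of the origin, at which a reflected solution is singular. -/
def puncturedCap (e : E) (Ω : Set E) (l : ℝ) : Set E := cap e Ω l \ {planeReflection e l 0}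

theorem le_inner_of_mem_closure_cap (hx : x ∈ closure (cap e Ω l)) : l ≤ inner ℝ e x :=
  have h : IsClosed {x : E | l ≤ inner ℝ e x} :=
    isClosed_le continuous_const (continuous_const.inner continuous_id)
  closure_minimal (fun y hy => (le_of_lt hy.2 : l ≤ inner ℝ e y)) h hx

theorem closure_cap_subset (e : E) (Ω : Set E) (l : ℝ) : closure (cap e Ω l) ⊆ closure Ω :=
  closure_mono fun _ hx => hx.1

theorem isSteinerDomain_ball (he : ‖e‖ = 1) (R : ℝ) : IsSteinerDomain e (Metric.ball 0 R) where
  norm_eq := he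
  isOpen := Metric.isOpen_ball
  isBounded := Metric.isBounded_ball
  slide x hx t ht := by
    rw [mem_ball_zero_iff] at hx ⊢
    refine lt_of_le_of_lt ?_ hx
    rw [← sq_le_sq₀ (norm_nonneg _) (norm_nonneg _), norm_add_sq_real, inner_smul_right, norm_smul,
      mul_pow, he, Real.norm_eq_abs, sq_abs, real_inner_comm]
    have hsq := sq_le_sq.2 ht
    rw [real_inner_comm] at hsq
    linarith

namespace IsSteinerDomain

theorem neg (hΩ : IsSteinerDomain e Ω) : IsSteinerDomain (-e) Ω where
  norm_eq := by rw [norm_neg, hΩ.norm_eq]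
  isOpen := hΩ.isOpen
  isBounded := hΩ.isBounded
  slide x hx t ht := by
    convert hΩ.slide x hx (-t) (by simpa using ht) using 1
    rw [inner_neg_left]
    module

theorem isOpen_cap (hΩ : IsSteinerDomain e Ω) (l : ℝ) : IsOpen (cap e Ω l) :=
  have h : IsOpen {x : E | l < inner ℝ e x} :=
    isOpen_lt continuous_const (continuous_const.inner continuous_id)
  hΩ.isOpen.inter h

theorem isBounded_cap (hΩ : IsSteinerDomain e Ω) (l : ℝ) : Bornology.IsBounded (cap e Ω l) :=
  hΩ.isBounded.subset fun _ hx => hx.1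

theorem isOpen_puncturedCap (hΩ : IsSteinerDomain e Ω) (l : ℝ) : IsOpen (puncturedCap e Ω l) :=
  (hΩ.isOpen_cap l).sdiff isClosed_singleton

theorem add_smul_mem (hΩ : IsSteinerDomain e Ω) {t : ℝ} (ht : x + t • e ∈ Ω) {s : ℝ}
    (hs : |(inner ℝ e x : ℝ) + s| ≤ inner ℝ e x + t) : x + s • e ∈ Ω := by
  have h := hΩ.slide _ ht (inner ℝ e x + s)
    (by simpa only [inner_add_smul_self hΩ.norm_eq] using hs.trans (le_abs_self _))
  rw [inner_add_smul_self hΩ.norm_eq] at h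
  convert h using 1
  module

theorem planeReflection_mem (hΩ : IsSteinerDomain e Ω) (hl : 0 ≤ l) (hx : x ∈ Ω)
    (hlx : l ≤ inner ℝ e x) : planeReflection e l x ∈ Ω :=
  hΩ.add_smul_mem (t := 0) (by simpa using hx) (abs_le.2 ⟨by linarith, by linarith⟩)

theorem planeReflection_zero_mem (hΩ : IsSteinerDomain e Ω) (hx : x ∈ Ω) :
    planeReflection e 0 x ∈ Ω := by
  have h := hΩ.slide x hx (-inner ℝ e x) (by simp)
  convert h using 1
  rw [planeReflection]
  module

theorem mem_diff_zero (hΩ : IsSteinerDomain e Ω) (hl : 0 ≤ l) (hx : x ∈ puncturedCap e Ω l) :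
    x ∈ Ω \ {0} ∧ planeReflection e l x ∈ Ω \ {0} :=
  ⟨⟨hx.1.1, ne_zero_of_inner_pos (hl.trans_lt hx.1.2)⟩,
    hΩ.planeReflection_mem hl hx.1.1 hx.1.2.le, planeReflection_ne_zero hΩ.norm_eq hx.2⟩

theorem exists_exit (hΩ : IsSteinerDomain e Ω) (hx : x ∈ Ω) :
    ∃ a > 0, x + a • e ∉ Ω ∧
      ∀ s, |(inner ℝ e x : ℝ) + s| < inner ℝ e x + a → x + s • e ∈ Ω := by
  set I : Set ℝ := {t | 0 ≤ t ∧ x + t • e ∈ Ω}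
  have hzero : (0 : ℝ) ∈ I := ⟨le_rfl, by simpa using hx⟩
  have hbdd : BddAbove I := by
    obtain ⟨ρ, hρ⟩ := hΩ.isBounded.subset_closedBall 0
    refine ⟨ρ - inner ℝ e x, fun t ht => ?_⟩
    have hle := real_inner_le_norm e (x + t • e)
    rw [inner_add_smul_self hΩ.norm_eq, hΩ.norm_eq, one_mul] at hle
    linarith [mem_closedBall_zero_iff.1 (hρ ht.2)]
  have hnonneg : 0 ≤ sSup I := le_csSup hbdd hzero
  have hexit : x + sSup I • e ∉ Ω := fun hmem => by
    have hline : Continuous fun t : ℝ => x + t • e := by fun_prop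
    have hmem' : ∀ᶠ t in 𝓝[>] sSup I, x + t • e ∈ Ω :=
      (hline.continuousAt.eventually (hΩ.isOpen.mem_nhds hmem)).filter_mono nhdsWithin_le_nhds
    obtain ⟨t, ht, hlt : sSup I < t⟩ := (hmem'.and eventually_mem_nhdsWithin).exists
    exact hlt.not_ge (le_csSup hbdd ⟨hnonneg.trans hlt.le, ht⟩)
  refine ⟨sSup I, hnonneg.lt_of_ne fun h => hexit (by simpa [← h] using hx), hexit,
    fun s hs => ?_⟩
  obtain ⟨t, ht, hst⟩ := exists_lt_of_lt_csSup ⟨0, hzero⟩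
    (show |(inner ℝ e x : ℝ) + s| - inner ℝ e x < sSup I by linarith)
  exact hΩ.add_smul_mem ht.2 (by linarith)

theorem eventually_cap_diff_subset (hΩ : IsSteinerDomain e Ω) [FiniteDimensional ℝ E]
    {l₀ : ℝ} {K O : Set E} (hO : IsOpen O) (hcap : cap e Ω l₀ \ K ⊆ O)
    (hplane : {x | inner ℝ e x = l₀} ⊆ O) : ∀ᶠ l in 𝓝 l₀, cap e Ω l \ K ⊆ O := by
  have hC : IsCompact (closure Ω \ O) := hΩ.isBounded.isCompact_closure.diff hO
  have hci : Continuous fun q : ℝ × E => (inner ℝ e q.2 : ℝ) :=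
    continuous_const.inner continuous_snd
  have h := hC.eventually_forall_of_forall_eventually (x₀ := l₀)
    (P := fun l x => x ∉ O → x ∉ cap e Ω l \ K) (fun x hx => ?_)
  · filter_upwards [h] with l hl x hx
    by_contra hxO
    exact hl x ⟨subset_closure hx.1.1, hxO⟩ hxO hx
  · rcases lt_trichotomy (inner ℝ e x : ℝ) l₀ with h | h | h
    · filter_upwards [hci.continuousAt.eventually_lt continuous_fst.continuousAt h] with q hq _ hqc
      exact hq.not_gt hqc.1.2
    · exact absurd (hplane h) hx.2
    · filter_upwards [continuousAt_const.eventually_lt hci.continuousAt h] with q hq hqO hqc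
      exact hqO (hcap ⟨⟨hqc.1.1, hq⟩, hqc.2⟩)

end IsSteinerDomain

variable [FiniteDimensional ℝ E] [MeasurableSpace E] [BorelSpace E]

theorem volume_inner_eq (he : ‖e‖ = 1) (l : ℝ) : volume {x : E | inner ℝ e x = l} = 0 := by
  set A : AffineSubspace ℝ E := AffineSubspace.mk' (l • e) (ℝ ∙ e)ᗮ with hA
  have hself : ∀ r : ℝ, inner ℝ e (r • e) = r := fun r => by
    simpa using inner_add_smul_self he 0 r
  have hmem : ∀ x, x ∈ A ↔ inner ℝ e x = l := fun x => by
    rw [hA, AffineSubspace.mem_mk', Submodule.mem_orthogonal_singleton_iff_inner_right, vsub_eq_sub,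
      inner_sub_right, hself, sub_eq_zero]
  have htop : A ≠ ⊤ := fun h => by
    have hmem_top : (l + 1) • e ∈ A := by rw [h]; trivial
    rw [hmem, hself] at hmem_top
    linarith
  convert Measure.addHaar_affineSubspace volume A htop using 2
  ext x
  exact (hmem x).symm

theorem IsSteinerDomain.exists_isCompact_volume_cap_diff_lt (hΩ : IsSteinerDomain e Ω)
    (l₀ : ℝ) {δ : ENNReal} (hδ : 0 < δ) :
    ∃ K ⊆ puncturedCap e Ω l₀, IsCompact K ∧ ∀ᶠ l in 𝓝 l₀, volume (cap e Ω l \ K) < δ := by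
  have hfin : volume (puncturedCap e Ω l₀) ≠ ⊤ :=
    ((hΩ.isBounded_cap l₀).subset sdiff_subset).measure_lt_top.ne
  obtain ⟨K, hK, hKc, hKδ⟩ :=
    (hΩ.isOpen_puncturedCap l₀).measurableSet.exists_isCompact_sdiff_lt hfin hδ.ne'
  set Z : Set E := {planeReflection e l₀ 0} ∪ {x : E | inner ℝ e x = l₀}
  have hZ : volume Z = 0 := by
    have : Nontrivial E := ⟨e, 0, norm_ne_zero_iff.1 (by simp [hΩ.norm_eq])⟩
    exact measure_union_null (measure_singleton _) (volume_inner_eq hΩ.norm_eq l₀)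
  have hlt : volume (puncturedCap e Ω l₀ \ K ∪ Z) < δ := by
    refine (measure_union_le _ _).trans_lt ?_
    rwa [hZ, add_zero]
  obtain ⟨O, hsub, hO, hOδ⟩ := exists_isOpen_lt_of_lt _ δ hlt
  have hcap : cap e Ω l₀ \ K ⊆ O := fun x hx => by
    by_cases hxp : x = planeReflection e l₀ 0
    · exact hsub (Or.inr (Or.inl hxp))
    · exact hsub (Or.inl ⟨⟨hx.1, hxp⟩, hx.2⟩)
  refine ⟨K, hK, hKc, ?_⟩
  filter_upwards [hΩ.eventually_cap_diff_subset hO hcap fun x hx => hsub (Or.inr (Or.inr hx))]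
    with l hl
  exact (measure_mono hl).trans_lt hOδ

end Reflection

section PlaneDiff

open Laplacian

variable {E : Type*} [NormedAddCommGroup E] [InnerProductSpace ℝ E] {e : E} {Ω : Set E} {v : E → ℝ}
  {l : ℝ} {x : E}

/-- The difference `v (x^l) - v x` of the method of moving planes, where `x^l` is the mirror image
of `x` in the hyperplane `⟪e, x⟫ = l`. -/
noncomputable def planeDiff (e : E) (v : E → ℝ) (l : ℝ) (x : E) : ℝ :=
  v (planeReflection e l x) - v x

/-- The comparison `v x ≤ v (x^l)` on the cap at level `l`, away from the mirror image of `0`. -/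
def PlaneDiffNonneg (e : E) (Ω : Set E) (v : E → ℝ) (l : ℝ) : Prop :=
  ∀ x ∈ puncturedCap e Ω l, 0 ≤ planeDiff e v l x

theorem continuousAt_planeDiff_prod (h : ContinuousAt v x)
    (h' : ContinuousAt v (planeReflection e l x)) :
    ContinuousAt (fun q : ℝ × E => planeDiff e v q.1 q.2) (l, x) := by
  have hrefl : ContinuousAt (fun q : ℝ × E => planeReflection e q.1 q.2) (l, x) :=
    (continuous_planeReflection e).continuousAt
  have hsnd : ContinuousAt (Prod.snd : ℝ × E → E) (l, x) := continuousAt_snd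
  exact (h'.comp_of_eq hrefl rfl).sub (h.comp_of_eq hsnd rfl)

theorem continuousAt_planeDiff (h : ContinuousAt v x)
    (h' : ContinuousAt v (planeReflection e l x)) : ContinuousAt (planeDiff e v l) x :=
  ContinuousAt.comp (f := fun y : E => (l, y)) (continuousAt_planeDiff_prod h h') (by fun_prop)

theorem contDiffAt_comp_planeReflection {k : WithTop ℕ∞}
    (h : ContDiffAt ℝ k v (planeReflection e l x)) :
    ContDiffAt ℝ k (fun y => v (planeReflection e l y)) x :=
  h.comp x (contDiff_id.add ((contDiff_const.mul (contDiff_const.sub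
    (contDiff_const.inner ℝ contDiff_id))).smul contDiff_const)).contDiffAt

theorem contDiffAt_planeDiff {k : WithTop ℕ∞} (h : ContDiffAt ℝ k v x)
    (h' : ContDiffAt ℝ k v (planeReflection e l x)) : ContDiffAt ℝ k (planeDiff e v l) x :=
  (contDiffAt_comp_planeReflection h').sub h

theorem laplacian_planeDiff [FiniteDimensional ℝ E] (he : ‖e‖ = 1) (h : ContDiffAt ℝ 2 v x)
    (h' : ContDiffAt ℝ 2 v (planeReflection e l x)) :
    Δ (planeDiff e v l) x = Δ v (planeReflection e l x) - Δ v x := by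
  have hrefl := laplacian_comp_affineIsometry (ℝ ∙ e)ᗮ.reflection ((2 * l) • e) (v := v) (x := x)
    (by rwa [← planeReflection_eq_reflection_add he])
  simp only [← planeReflection_eq_reflection_add he] at hrefl
  rw [← hrefl]
  exact (contDiffAt_comp_planeReflection h').laplacian_sub h

end PlaneDiff

section TorsionBarrier

open Laplacian

variable {E : Type*} [NormedAddCommGroup E] [InnerProductSpace ℝ E] [FiniteDimensional ℝ E]

/-- A solution `q` of `-Δ q = 1` with values in `[0, C]` on `S`. It turns a lower bound for `-Δ w`
into a lower bound for `w`. -/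
structure IsTorsionBarrier (q : E → ℝ) (C : ℝ) (S : Set E) : Prop where
  contDiffAt : ∀ x, ContDiffAt ℝ 2 q x
  laplacian_eq : ∀ x, Δ q x = -1
  nonneg : ∀ x ∈ S, 0 ≤ q x
  le : ∀ x ∈ S, q x ≤ C

theorem IsTorsionBarrier.mono {q : E → ℝ} {C : ℝ} {S T : Set E} (h : IsTorsionBarrier q C T)
    (hST : S ⊆ T) : IsTorsionBarrier q C S where
  contDiffAt := h.contDiffAt
  laplacian_eq := h.laplacian_eq
  nonneg x hx := h.nonneg x (hST hx)
  le x hx := h.le x (hST hx)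

theorem exists_isTorsionBarrier [Nontrivial E] (R : ℝ) :
    ∃ (q : E → ℝ) (C : ℝ), 0 < C ∧ IsTorsionBarrier q C (Metric.ball 0 R) := by
  have hd : (0 : ℝ) < Module.finrank ℝ E := by exact_mod_cast Module.finrank_pos
  set d := (Module.finrank ℝ E : ℝ) with hd_def
  have hball : ∀ x ∈ Metric.ball (0 : E) R, ‖x - 0‖ ^ 2 ≤ R ^ 2 := fun x hx => by
    rw [sub_zero]
    gcongr
    exact (mem_ball_zero_iff.1 hx).le
  refine ⟨fun x => (R ^ 2 - ‖x - 0‖ ^ 2) / (2 * d), (R ^ 2 + 1) / (2 * d), by positivity,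
    fun x => ?_, fun x => ?_, fun x hx => ?_, fun x _ => ?_⟩
  · exact contDiffAt_comp_norm_sub_sq (g := fun t => (R ^ 2 - t) / (2 * d)) (by fun_prop)
  · rw [laplacian_comp_norm_sub_sq (g := fun t => (R ^ 2 - t) / (2 * d))
      (g₁ := fun _ => (-1) / (2 * d)) (g₂ := 0)
      (Eventually.of_forall fun t => ((hasDerivAt_id t).const_sub _).div_const _)
      (hasDerivAt_const _ _), ← hd_def]
    field_simp
    ring
  · exact div_nonneg (sub_nonneg.2 (hball x hx)) (by positivity)
  · gcongr
    linarith [sq_nonneg ‖x - 0‖]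

end TorsionBarrier

section NavierSystem

open Laplacian

variable {E : Type*} [NormedAddCommGroup E] [InnerProductSpace ℝ E] [FiniteDimensional ℝ E]

/-- The equation `(-Δ)^m u = f(u)` in `Ω \ {0}` with Navier conditions, as the second-order system
satisfied by `V j = (-Δ)^j u`: `-Δ (V j) = V (j + 1)` for `j < m`, and `V m = f (V 0)`. The
functions `V j` with `j < m` are extended by zero outside `Ω`, so that the Navier conditions become
continuity on the complement of the origin. -/
structure IsNavierSystem (m : ℕ) (Ω : Set E) (f : ℝ → ℝ) (V : ℕ → E → ℝ) : Prop where
  contDiffAt : ∀ j < m, ∀ x ∈ Ω \ {0}, ContDiffAt ℝ 2 (V j) x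
  laplacian_eq : ∀ j < m, ∀ x ∈ Ω \ {0}, Δ (V j) x = -V (j + 1) x
  last_eq : ∀ x ∈ Ω \ {0}, V m x = f (V 0 x)
  pos : ∀ x ∈ Ω \ {0}, 0 < V 0 x
  continuousAt : ∀ j < m, ∀ x ≠ 0, ContinuousAt (V j) x
  eq_zero : ∀ j < m, ∀ x ∉ Ω, V j x = 0
  bddBelow : ∀ j < m, BddBelow (V j '' (Ω \ {0}))

variable {m j : ℕ} {e x : E} {Ω : Set E} {f : ℝ → ℝ} {V : ℕ → E → ℝ} {l : ℝ}

namespace IsNavierSystem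

theorem nonneg_of_succ_nonneg (hd : 2 ≤ Module.finrank ℝ E) (hV : IsNavierSystem m Ω f V)
    (hΩ : IsOpen Ω) (hb : Bornology.IsBounded Ω) (hj : j < m)
    (h : ∀ x ∈ Ω \ {0}, 0 ≤ V (j + 1) x) : ∀ x ∈ Ω \ {0}, 0 ≤ V j x := by
  refine nonneg_of_superharmonic hd hΩ hb 0 (hV.contDiffAt j hj) (fun x hx => ?_) (hV.bddBelow j hj)
    (fun x hx => (hV.continuousAt j hj x hx.2).continuousWithinAt) fun y hy _ => ?_
  · rw [hV.laplacian_eq j hj x hx]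
    linarith [h x hx]
  · rw [frontier, hΩ.interior_eq] at hy
    exact (hV.eq_zero j hj y hy.2).ge

theorem nonneg (hd : 2 ≤ Module.finrank ℝ E) (hf : IsAdmissibleNonlinearity f)
    (hV : IsNavierSystem m Ω f V) (hΩ : IsOpen Ω) (hb : Bornology.IsBounded Ω) (hj : j < m)
    (hx : x ≠ 0) : 0 ≤ V j x := by
  by_cases hxΩ : x ∈ Ω
  · have h : ∀ i ≤ m, ∀ y ∈ Ω \ {0}, 0 ≤ V i y := by
      intro i hi
      induction hi using Nat.decreasingInduction with
      | of_succ i hi ih => exact hV.nonneg_of_succ_nonneg hd hΩ hb hi ih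
      | self =>
        intro y hy
        rw [hV.last_eq y hy]
        exact hf.zero_nonneg.trans
          (hf.monotone (mem_Ici.2 le_rfl) (hV.pos y hy).le (hV.pos y hy).le)
    exact h j hj.le x ⟨hxΩ, hx⟩
  · exact (hV.eq_zero j hj x hxΩ).ge

theorem continuousOn_planeDiff (hV : IsNavierSystem m Ω f V) (hΩ : IsSteinerDomain e Ω)
    (hl : 0 < l) (hj : j < m) :
    ContinuousOn (planeDiff e (V j) l) (closure (cap e Ω l) \ {planeReflection e l 0}) :=
  fun _ hx => (continuousAt_planeDiff
    (hV.continuousAt j hj _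
      (ne_zero_of_inner_pos (hl.trans_le (le_inner_of_mem_closure_cap hx.1))))
    (hV.continuousAt j hj _ (planeReflection_ne_zero hΩ.norm_eq hx.2))).continuousWithinAt

theorem contDiffAt_planeDiff (hV : IsNavierSystem m Ω f V) (hΩ : IsSteinerDomain e Ω)
    (hl : 0 ≤ l) (hj : j < m) (hx : x ∈ puncturedCap e Ω l) :
    ContDiffAt ℝ 2 (planeDiff e (V j) l) x :=
  have h := hΩ.mem_diff_zero hl hx
  _root_.contDiffAt_planeDiff (hV.contDiffAt j hj _ h.1) (hV.contDiffAt j hj _ h.2)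

theorem laplacian_planeDiff (hV : IsNavierSystem m Ω f V) (hΩ : IsSteinerDomain e Ω)
    (hl : 0 ≤ l) (hj : j < m) (hx : x ∈ puncturedCap e Ω l) :
    Δ (planeDiff e (V j) l) x = -planeDiff e (V (j + 1)) l x := by
  obtain ⟨h, h'⟩ := hΩ.mem_diff_zero hl hx
  rw [_root_.laplacian_planeDiff hΩ.norm_eq (hV.contDiffAt j hj _ h) (hV.contDiffAt j hj _ h'),
    hV.laplacian_eq j hj _ h, hV.laplacian_eq j hj _ h', planeDiff]
  ring

theorem planeDiff_nonneg_of_mem_frontier (hd : 2 ≤ Module.finrank ℝ E)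
    (hf : IsAdmissibleNonlinearity f) (hV : IsNavierSystem m Ω f V) (hΩ : IsSteinerDomain e Ω)
    (hj : j < m) (hx : x ∈ frontier (cap e Ω l)) (hxp : x ≠ planeReflection e l 0) :
    0 ≤ planeDiff e (V j) l x := by
  have hle := le_inner_of_mem_closure_cap (frontier_subset_closure hx)
  rw [frontier, (hΩ.isOpen_cap l).interior_eq] at hx
  rcases hle.eq_or_lt with heq | hlt
  · rw [planeDiff, planeReflection_of_inner_eq heq.symm, sub_self]
  · rw [planeDiff, hV.eq_zero j hj x fun hxΩ => hx.2 ⟨hxΩ, hlt⟩, sub_zero]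
    exact hV.nonneg hd hf hΩ.isOpen hΩ.isBounded hj (planeReflection_ne_zero hΩ.norm_eq hxp)

theorem bddBelow_planeDiff (hd : 2 ≤ Module.finrank ℝ E) (hf : IsAdmissibleNonlinearity f)
    (hV : IsNavierSystem m Ω f V) (hΩ : IsSteinerDomain e Ω) (hl : 0 < l) (hj : j < m) :
    BddBelow (planeDiff e (V j) l '' puncturedCap e Ω l) := by
  obtain ⟨M, hM⟩ := (hΩ.isBounded_cap l).isCompact_closure.bddAbove_image (f := V j)
    fun x hx => (hV.continuousAt j hj x
      (ne_zero_of_inner_pos (hl.trans_le (le_inner_of_mem_closure_cap hx)))).continuousWithinAt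
  refine ⟨-M, ?_⟩
  rintro _ ⟨x, hx, rfl⟩
  have hle := hM (mem_image_of_mem _ (subset_closure hx.1))
  have hnonneg := hV.nonneg hd hf hΩ.isOpen hΩ.isBounded hj (hΩ.mem_diff_zero hl.le hx).2.2
  rw [planeDiff]
  linarith

theorem planeDiff_add_nonneg (hd : 2 ≤ Module.finrank ℝ E) (hf : IsAdmissibleNonlinearity f)
    (hV : IsNavierSystem m Ω f V) (hΩ : IsSteinerDomain e Ω) (hl : 0 < l) (hj : j < m) {ψ : E → ℝ}
    (hψ : ∀ x, ContDiffAt ℝ 2 ψ x) (hψ0 : ∀ x ∈ closure (cap e Ω l), 0 ≤ ψ x)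
    (hΔ : ∀ x ∈ puncturedCap e Ω l, Δ ψ x ≤ planeDiff e (V (j + 1)) l x) :
    ∀ x ∈ puncturedCap e Ω l, 0 ≤ planeDiff e (V j) l x + ψ x := by
  have hcd := fun x hx => hV.contDiffAt_planeDiff hΩ hl.le hj (x := x) hx
  refine nonneg_of_superharmonic hd (hΩ.isOpen_cap l) (hΩ.isBounded_cap l) _
    (fun x hx => (hcd x hx).add (hψ x)) (fun x hx => ?_) ?_
    ((hV.continuousOn_planeDiff hΩ hl hj).add fun x _ => (hψ x).continuousAt.continuousWithinAt)
    fun y hy hyp => add_nonneg (hV.planeDiff_nonneg_of_mem_frontier hd hf hΩ hj hy hyp)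
      (hψ0 y (frontier_subset_closure hy))
  · have hadd : Δ (fun y => planeDiff e (V j) l y + ψ y) x = _ :=
      (hcd x hx).laplacian_add (hψ x)
    rw [hadd, hV.laplacian_planeDiff hΩ hl.le hj hx]
    linarith [hΔ x hx]
  · obtain ⟨M, hM⟩ := hV.bddBelow_planeDiff hd hf hΩ hl hj
    refine ⟨M, ?_⟩
    rintro _ ⟨x, hx, rfl⟩
    exact le_add_of_le_of_nonneg (hM (mem_image_of_mem _ hx)) (hψ0 x (subset_closure hx.1))

theorem neg_mul_le_planeDiff (hd : 2 ≤ Module.finrank ℝ E) (hf : IsAdmissibleNonlinearity f)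
    (hV : IsNavierSystem m Ω f V) (hΩ : IsSteinerDomain e Ω) (hl : 0 < l) (hj : j < m) {q : E → ℝ}
    {B C : ℝ} (hq : IsTorsionBarrier q C (closure (cap e Ω l))) (hB : 0 ≤ B)
    (h : ∀ x ∈ puncturedCap e Ω l, -B ≤ planeDiff e (V (j + 1)) l x) :
    ∀ x ∈ puncturedCap e Ω l, -(B * C) ≤ planeDiff e (V j) l x := by
  intro x hx
  have hsum : 0 ≤ planeDiff e (V j) l x + B * q x :=
    hV.planeDiff_add_nonneg hd hf hΩ hl hj (ψ := fun y => B * q y)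
      (fun y => contDiffAt_const.mul (hq.contDiffAt y)) (fun y hy => mul_nonneg hB (hq.nonneg y hy))
      (fun y hy => by
        rw [laplacian_const_mul B (hq.contDiffAt y), hq.laplacian_eq, mul_neg_one]
        exact h y hy) x hx
  have hle : B * q x ≤ B * C := mul_le_mul_of_nonneg_left (hq.le x (subset_closure hx.1)) hB
  linarith

theorem neg_mul_pow_le_planeDiff_zero (hd : 2 ≤ Module.finrank ℝ E)
    (hf : IsAdmissibleNonlinearity f) (hV : IsNavierSystem m Ω f V) (hΩ : IsSteinerDomain e Ω)
    (hl : 0 < l) (hj : j ≤ m) {q : E → ℝ} {B C : ℝ}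
    (hq : IsTorsionBarrier q C (closure (cap e Ω l))) (hB : 0 ≤ B) (hC : 0 ≤ C)
    (h : ∀ x ∈ puncturedCap e Ω l, -B ≤ planeDiff e (V j) l x) :
    ∀ x ∈ puncturedCap e Ω l, -(B * C ^ j) ≤ planeDiff e (V 0) l x := by
  induction j generalizing B with
  | zero => simpa using h
  | succ j ih =>
    rw [pow_succ', ← mul_assoc]
    exact ih (by omega) (mul_nonneg hB hC) (hV.neg_mul_le_planeDiff hd hf hΩ hl hj hq hB h)

theorem planeDiffNonneg_of_zero (hd : 2 ≤ Module.finrank ℝ E) (hf : IsAdmissibleNonlinearity f)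
    (hV : IsNavierSystem m Ω f V) (hΩ : IsSteinerDomain e Ω) (hl : 0 < l) (hj : j ≤ m)
    (h : PlaneDiffNonneg e Ω (V 0) l) : PlaneDiffNonneg e Ω (V j) l := by
  induction hj using Nat.decreasingInduction with
  | of_succ i hi ih =>
    intro x hx
    simpa using hV.planeDiff_add_nonneg hd hf hΩ hl hi (ψ := fun _ => 0)
      (fun _ => contDiffAt_const) (fun _ _ => le_rfl)
      (fun y hy => by simpa [InnerProductSpace.laplacian_const] using ih y hy) x hx
  | self =>
    intro x hx
    obtain ⟨hmem, hmem'⟩ := hΩ.mem_diff_zero hl.le hx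
    rw [planeDiff, hV.last_eq _ hmem, hV.last_eq _ hmem', sub_nonneg]
    exact hf.monotone (hV.pos _ hmem).le (hV.pos _ hmem').le (sub_nonneg.1 (h x hx))

theorem laplacian_planeDiff_zero_nonpos (hd : 2 ≤ Module.finrank ℝ E)
    (hf : IsAdmissibleNonlinearity f) (hV : IsNavierSystem m Ω f V) (hΩ : IsSteinerDomain e Ω)
    (hm : 0 < m) (hl : 0 < l) (h : PlaneDiffNonneg e Ω (V 0) l) (hx : x ∈ puncturedCap e Ω l) :
    Δ (planeDiff e (V 0) l) x ≤ 0 := by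
  rw [hV.laplacian_planeDiff hΩ hl.le hm hx, neg_nonpos]
  exact hV.planeDiffNonneg_of_zero hd hf hΩ hl hm h x hx

theorem planeDiff_zero_pos_of_notMem (hV : IsNavierSystem m Ω f V) (hm : 0 < m) (hx : x ∉ Ω)
    (hx' : planeReflection e l x ∈ Ω \ {0}) : 0 < planeDiff e (V 0) l x := by
  rw [planeDiff, hV.eq_zero 0 hm x hx, sub_zero]
  exact hV.pos _ hx'

/-- The segment from `x` in the direction `e` leaves `Ω` at a point where the difference is
positive, and it avoids the singularity; the strong maximum principle propagates positivity along
it. -/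
theorem planeDiff_zero_pos_of_ne (hd : 2 ≤ Module.finrank ℝ E) (hf : IsAdmissibleNonlinearity f)
    (hV : IsNavierSystem m Ω f V) (hΩ : IsSteinerDomain e Ω) (hm : 0 < m) (hl : 0 < l)
    (h : PlaneDiffNonneg e Ω (V 0) l) (hx : x ∈ cap e Ω l)
    (hxe : x ≠ (inner ℝ e x : ℝ) • e) : 0 < planeDiff e (V 0) l x := by
  have hlx := hx.2
  have hne : ∀ t : ℝ, x + t • e ≠ 0 := fun t => by
    simpa using add_smul_ne_smul hΩ.norm_eq hxe t 0
  obtain ⟨a, ha, hexit, hstay⟩ := hΩ.exists_exit hx.1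
  have hrefl : planeReflection e l (x + a • e) ∈ Ω \ {0} := by
    rw [planeReflection_add_smul_self hΩ.norm_eq]
    exact ⟨hstay _ (abs_lt.2 ⟨by linarith, by linarith⟩), hne _⟩
  have hpos : 0 < planeDiff e (V 0) l (x + a • e) := hV.planeDiff_zero_pos_of_notMem hm hexit hrefl
  have hseg : ∀ s ∈ Ico 0 a, x + s • e ∈ puncturedCap e Ω l := fun s hs => by
    refine ⟨⟨hstay s ?_, ?_⟩, ?_⟩
    · rw [abs_of_pos (by linarith [hs.1])]
      linarith [hs.2]
    · rw [inner_add_smul_self hΩ.norm_eq]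
      linarith [hs.1]
    · rw [mem_singleton_iff, planeReflection_zero_right]
      exact add_smul_ne_smul hΩ.norm_eq hxe s (2 * l)
  have hline : Continuous fun t : ℝ => x + t • e := by fun_prop
  have hcont : ContinuousAt (planeDiff e (V 0) l ∘ fun t : ℝ => x + t • e) a :=
    ContinuousAt.comp (continuousAt_planeDiff (hV.continuousAt 0 hm _ (hne a))
      (hV.continuousAt 0 hm _ hrefl.2)) hline.continuousAt
  have hmem : x ∈ (fun s : ℝ => x + s • e) '' Ico 0 a := ⟨0, ⟨le_rfl, ha⟩, by simp⟩
  obtain ⟨t, hpos_t, ht⟩ := (((hcont.eventually (lt_mem_nhds hpos)).filter_mono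
    nhdsWithin_le_nhds).and (Ico_mem_nhdsLT ha)).exists
  exact pos_of_superharmonic (hΩ.isOpen_puncturedCap l)
    (fun y hy => hV.contDiffAt_planeDiff hΩ hl.le hm hy)
    (fun y hy => hV.laplacian_planeDiff_zero_nonpos hd hf hΩ hm hl h hy) h
    (isPreconnected_Ico.image _ hline.continuousOn) (image_subset_iff.2 hseg)
    (mem_image_of_mem _ ht) hpos_t x hmem

theorem planeDiff_zero_pos (hd : 2 ≤ Module.finrank ℝ E) (hf : IsAdmissibleNonlinearity f)
    (hV : IsNavierSystem m Ω f V) (hΩ : IsSteinerDomain e Ω) (hm : 0 < m) (hl : 0 < l)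
    (h : PlaneDiffNonneg e Ω (V 0) l) :
    ∀ x ∈ puncturedCap e Ω l, 0 < planeDiff e (V 0) l x := by
  intro x hx
  have hopen := hΩ.isOpen_puncturedCap l
  have hsub : puncturedCap e Ω l ∩ {y | y ≠ (inner ℝ e y : ℝ) • e} ⊆
      {y ∈ puncturedCap e Ω l | 0 < planeDiff e (V 0) l y} := fun y hy =>
    ⟨hy.1, hV.planeDiff_zero_pos_of_ne hd hf hΩ hm hl h hy.1.1 hy.2⟩
  have hmem : x ∈ closure {y ∈ puncturedCap e Ω l | 0 < planeDiff e (V 0) l y} :=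
    closure_mono hsub ((dense_ne_inner_smul hd e).open_subset_closure_inter hopen hx)
  exact (closure_pos_inter_subset hopen (fun y hy => hV.contDiffAt_planeDiff hΩ hl.le hm hy)
    (fun y hy => hV.laplacian_planeDiff_zero_nonpos hd hf hΩ hm hl h hy) h ⟨hmem, hx⟩).2

end IsNavierSystem

end NavierSystem

section SmallVolume

open MeasureTheory Laplacian

theorem sub_le_mul_max_sub {f : ℝ → ℝ} {s : Set ℝ} {L : ℝ≥0} (hmono : MonotoneOn f s)
    (hlip : LipschitzOnWith L f s) {a b : ℝ} (ha : a ∈ s) (hb : b ∈ s) :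
    f a - f b ≤ L * max (a - b) 0 := by
  rcases le_total a b with h | h
  · rw [max_eq_right (sub_nonpos.2 h), mul_zero, sub_nonpos]
    exact hmono ha hb h
  · rw [max_eq_left (sub_nonneg.2 h)]
    have hdist := hlip.dist_le_mul a ha b hb
    rw [Real.dist_eq, Real.dist_eq, abs_of_nonneg (sub_nonneg.2 h)] at hdist
    exact (le_abs_self _).trans hdist

theorem nonneg_of_forall_neg_half_le {α : Type*} {g : α → ℝ} {S : Set α} (hb : BddBelow (g '' S))
    (h : ∀ M > 0, (∀ x ∈ S, -M ≤ g x) → ∀ x ∈ S, -(M / 2) ≤ g x) : ∀ x ∈ S, 0 ≤ g x := by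
  intro x hx
  by_contra! hneg
  have hle : ∀ y ∈ S, sInf (g '' S) ≤ g y := fun y hy => csInf_le hb (mem_image_of_mem g hy)
  have hinf : sInf (g '' S) < 0 := (hle x hx).trans_lt hneg
  have hhalf := h (-sInf (g '' S)) (neg_pos.2 hinf) (by simpa using hle)
  have hinf_half : sInf (g '' S) / 2 ≤ sInf (g '' S) := by
    refine le_csInf ⟨g x, mem_image_of_mem g hx⟩ ?_
    rintro _ ⟨y, hy, rfl⟩
    linarith [hhalf y hy]
  linarith

theorem isCompact_sep_eq_or_le {X : Type*} [TopologicalSpace X] [T1Space X] {S : Set X}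
    (hS : IsCompact S) {p : X} {w : X → ℝ} (hw : ContinuousOn w (S \ {p})) (c : ℝ) :
    IsCompact {x ∈ S | x = p ∨ w x ≤ c} := by
  obtain ⟨U, hU, hUw⟩ := continuousOn_iff'.1 hw (Ioi c) isOpen_Ioi
  convert hS.diff (hU.sdiff (isClosed_singleton (x := p))) using 1
  ext x
  have hx := Set.ext_iff.1 hUw x
  simp only [mem_inter_iff, mem_preimage, mem_Ioi, Set.mem_sdiff, mem_singleton_iff] at hx
  simp only [mem_ofPred_eq, Set.mem_sdiff, mem_singleton_iff, ← not_lt (a := c)]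
  tauto

variable {E : Type*} [NormedAddCommGroup E] [InnerProductSpace ℝ E] [FiniteDimensional ℝ E]
  [MeasurableSpace E] [BorelSpace E]

theorem exists_small_potential_of_neg [Nontrivial E] {ε : ℝ} (hε : 0 < ε) (R : ℝ) :
    ∃ τ > 0, ∃ δ > 0, ∀ D : Set E, IsCompact D → D ⊆ Metric.ball 0 R → volume D < δ →
      ∃ σ : E → ℝ, (∀ x, ContDiffAt ℝ 2 σ x) ∧ (∀ x, Δ σ x ≤ -τ) ∧ (∀ x ∈ D, Δ σ x ≤ -1) ∧
        ∀ x ∈ Metric.ball 0 R, 0 ≤ σ x ∧ σ x ≤ ε := by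
  obtain ⟨q, C, hC, hq⟩ := exists_isTorsionBarrier (E := E) R
  obtain ⟨δ, hδ, hpot⟩ := exists_small_potential E (half_pos hε) R
  set τ := ε / 2 / C with hτ_def
  have hτ : 0 < τ := by positivity
  refine ⟨τ, hτ, δ, hδ, fun D hD hDR hDδ => ?_⟩
  obtain ⟨φ, hφ, hφΔ, hφD, hφε⟩ := hpot D hD hDR hDδ
  have hΔ : ∀ x, Δ (fun y => φ y + τ * q y) x = Δ φ x - τ := fun x => by
    rw [laplacian_add_const_mul τ (hφ x) (hq.contDiffAt x), hq.laplacian_eq]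
    ring
  refine ⟨fun y => φ y + τ * q y, fun x => (hφ x).add (contDiffAt_const.mul (hq.contDiffAt x)),
    fun x => ?_, fun x hx => ?_, fun x hx => ⟨?_, ?_⟩⟩
  · linarith [hΔ x, hφΔ x]
  · linarith [hΔ x, hφD x hx]
  · exact add_nonneg (hφε x hx).1 (mul_nonneg hτ.le (hq.nonneg x hx))
  · calc φ x + τ * q x ≤ ε / 2 + τ * C :=
          add_le_add (hφε x hx).2 (mul_le_mul_of_nonneg_left (hq.le x hx) hτ.le)
      _ = ε := by rw [hτ_def, div_mul_cancel₀ _ hC.ne', add_halves]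

end SmallVolume

section MovingPlanes

open MeasureTheory Laplacian

variable {E : Type*} [NormedAddCommGroup E] [InnerProductSpace ℝ E] [FiniteDimensional ℝ E]
  {m k : ℕ} {e x : E} {Ω : Set E} {f : ℝ → ℝ} {V : ℕ → E → ℝ} {l : ℝ}

/-- The points of the closed cap at which a comparison function `w` lies below `-c`, together with
the mirror image of the origin, where `w` need not be continuous. -/
def badSet (e : E) (Ω : Set E) (w : E → ℝ) (l c : ℝ) : Set E :=
  {x ∈ closure (cap e Ω l) | x = planeReflection e l 0 ∨ w x ≤ -c}

namespace IsNavierSystem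

theorem isCompact_badSet (hV : IsNavierSystem m Ω f V) (hΩ : IsSteinerDomain e Ω) (hm : 0 < m)
    (hl : 0 < l) (c : ℝ) : IsCompact (badSet e Ω (planeDiff e (V 0) l) l c) :=
  isCompact_sep_eq_or_le (hΩ.isBounded_cap l).isCompact_closure
    (hV.continuousOn_planeDiff hΩ hl hm) (-c)

theorem volume_badSet_le [MeasurableSpace E] [BorelSpace E] (hd : 2 ≤ Module.finrank ℝ E)
    (hf : IsAdmissibleNonlinearity f) (hV : IsNavierSystem m Ω f V) (hΩ : IsSteinerDomain e Ω)
    (hm : 0 < m) {c : ℝ} (hc : 0 < c) {K : Set E} (hK : ∀ x ∈ K, 0 ≤ planeDiff e (V 0) l x) :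
    volume (badSet e Ω (planeDiff e (V 0) l) l c) ≤ volume (cap e Ω l \ K) := by
  have : Nontrivial E := ⟨e, 0, norm_ne_zero_iff.1 (by simp [hΩ.norm_eq])⟩
  have hsub : badSet e Ω (planeDiff e (V 0) l) l c ⊆
      cap e Ω l \ K ∪ {planeReflection e l 0} := by
    rintro y ⟨hyc, hy⟩
    by_cases hyp : y = planeReflection e l 0
    · exact Or.inr hyp
    have hle := hy.resolve_left hyp
    refine Or.inl ⟨?_, fun hyK => by linarith [hK y hyK]⟩
    by_contra hycap
    have hfr : y ∈ frontier (cap e Ω l) := by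
      rw [frontier, (hΩ.isOpen_cap l).interior_eq]
      exact ⟨hyc, hycap⟩
    linarith [hV.planeDiff_nonneg_of_mem_frontier hd hf hΩ hm hfr hyp]
  calc volume (badSet e Ω (planeDiff e (V 0) l) l c)
      ≤ volume (cap e Ω l \ K) + volume {planeReflection e l 0} :=
        (measure_mono hsub).trans (measure_union_le _ _)
    _ = volume (cap e Ω l \ K) := by rw [measure_singleton, add_zero]

theorem neg_mul_max_le_planeDiff_last (hmono : MonotoneOn f (Ici 0)) {L : ℝ≥0}
    (hL : LipschitzOnWith L f (Ici 0)) (hV : IsNavierSystem m Ω f V) (hΩ : IsSteinerDomain e Ω)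
    (hl : 0 ≤ l) (hx : x ∈ puncturedCap e Ω l) :
    -(L * max (-planeDiff e (V 0) l x) 0) ≤ planeDiff e (V m) l x := by
  obtain ⟨h, h'⟩ := hΩ.mem_diff_zero hl hx
  have hsub := sub_le_mul_max_sub hmono hL (hV.pos _ h).le (hV.pos _ h').le
  rw [planeDiff, planeDiff, neg_sub, hV.last_eq _ h, hV.last_eq _ h']
  linarith

/-- The function `L M σ` compensates the negative part of the difference at the level `m = k + 1`:
on the bad set by `Δ σ ≤ -1`, and elsewhere by `Δ σ ≤ -τ`. -/
theorem neg_half_le_planeDiff_zero (hd : 2 ≤ Module.finrank ℝ E)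
    (hf : IsAdmissibleNonlinearity f) {L : ℝ≥0} (hL : LipschitzOnWith L f (Ici 0))
    (hV : IsNavierSystem (k + 1) Ω f V) (hΩ : IsSteinerDomain e Ω) (hl : 0 < l) {q σ : E → ℝ}
    {C M ε τ : ℝ} (hq : IsTorsionBarrier q C (closure (cap e Ω l))) (hC : 0 ≤ C) (hM : 0 < M)
    (hε : 0 ≤ ε) (hτ : 0 ≤ τ) (hsmall : L * ε * C ^ k ≤ 1 / 2)
    (hσ : ∀ x, ContDiffAt ℝ 2 σ x) (hσΔ : ∀ x, Δ σ x ≤ -τ)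
    (hσbad : ∀ x ∈ badSet e Ω (planeDiff e (V 0) l) l (M * τ), Δ σ x ≤ -1)
    (hσ0 : ∀ x ∈ closure (cap e Ω l), 0 ≤ σ x ∧ σ x ≤ ε)
    (hlow : ∀ x ∈ puncturedCap e Ω l, -M ≤ planeDiff e (V 0) l x) :
    ∀ x ∈ puncturedCap e Ω l, -(M / 2) ≤ planeDiff e (V 0) l x := by
  have hLM : 0 ≤ L * M := by positivity
  have hneg : ∀ x ∈ puncturedCap e Ω l, max (-planeDiff e (V 0) l x) 0 ≤ M * -Δ σ x := by
    intro x hx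
    have hΔτ := mul_le_mul_of_nonneg_left (le_neg.1 (hσΔ x)) hM.le
    by_cases hxbad : planeDiff e (V 0) l x ≤ -(M * τ)
    · have hΔ1 := mul_le_mul_of_nonneg_left
        (le_neg.1 (hσbad x ⟨subset_closure hx.1, Or.inr hxbad⟩)) hM.le
      exact max_le (by linarith [hlow x hx]) (by linarith)
    · exact max_le (by linarith) ((mul_nonneg hM.le hτ).trans hΔτ)
  have hlast : ∀ x ∈ puncturedCap e Ω l, 0 ≤ planeDiff e (V k) l x + L * M * σ x :=
    hV.planeDiff_add_nonneg hd hf hΩ hl k.lt_succ_self (fun x => contDiffAt_const.mul (hσ x))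
      (fun x hx => mul_nonneg hLM (hσ0 x hx).1) fun x hx => by
        rw [laplacian_const_mul _ (hσ x)]
        have hmul := mul_le_mul_of_nonneg_left (hneg x hx) L.coe_nonneg
        linarith [hV.neg_mul_max_le_planeDiff_last hf.monotone hL hΩ hl.le hx]
  have hk : ∀ x ∈ puncturedCap e Ω l, -(L * M * ε) ≤ planeDiff e (V k) l x := fun x hx => by
    have hle := mul_le_mul_of_nonneg_left (hσ0 x (subset_closure hx.1)).2 hLM
    linarith [hlast x hx]
  intro x hx
  have hzero :=
    hV.neg_mul_pow_le_planeDiff_zero hd hf hΩ hl k.le_succ hq (by positivity) hC hk x hx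
  have hmul := mul_le_mul_of_nonneg_left hsmall hM.le
  linarith

theorem exists_planeDiffNonneg_of_volume_lt [MeasurableSpace E] [BorelSpace E]
    (hd : 2 ≤ Module.finrank ℝ E) (hf : IsAdmissibleNonlinearity f) (hV : IsNavierSystem m Ω f V)
    (hΩ : IsSteinerDomain e Ω) (hm : 0 < m) :
    ∃ δ > 0, ∀ l > 0, ∀ K : Set E, volume (cap e Ω l \ K) < δ →
      (∀ x ∈ K, 0 ≤ planeDiff e (V 0) l x) → PlaneDiffNonneg e Ω (V 0) l := by
  obtain ⟨k, rfl⟩ := Nat.exists_eq_succ_of_ne_zero hm.ne'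
  have : Nontrivial E := Module.nontrivial_of_finrank_pos (R := ℝ) (by omega)
  obtain ⟨L, hL⟩ := hf.lipschitz
  obtain ⟨R, hR⟩ := hΩ.isBounded.closure.subset_ball 0
  obtain ⟨q, C, hC, hq⟩ := exists_isTorsionBarrier (E := E) R
  obtain ⟨ε, hε, hsmall⟩ : ∃ ε > 0, L * ε * C ^ k ≤ 1 / 2 := by
    have hpos : 0 < L * C ^ k + 1 := by positivity
    refine ⟨1 / 2 / (L * C ^ k + 1), by positivity, ?_⟩
    rw [mul_right_comm, mul_div_assoc', div_le_iff₀ hpos]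
    linarith
  obtain ⟨τ, hτ, δ, hδ, hpot⟩ := exists_small_potential_of_neg (E := E) hε R
  refine ⟨δ, hδ, fun l hl K hKδ hK => ?_⟩
  have hcap : closure (cap e Ω l) ⊆ Metric.ball 0 R := (closure_cap_subset e Ω l).trans hR
  refine nonneg_of_forall_neg_half_le (hV.bddBelow_planeDiff hd hf hΩ hl hm) fun M hM hlow => ?_
  obtain ⟨σ, hσ, hσΔ, hσbad, hσ0⟩ := hpot _ (hV.isCompact_badSet hΩ hm hl (M * τ))
    (fun x hx => hcap hx.1)
    ((hV.volume_badSet_le hd hf hΩ hm (mul_pos hM hτ) hK).trans_lt hKδ)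
  exact hV.neg_half_le_planeDiff_zero hd hf hL hΩ hl (hq.mono hcap) hC.le hM hε.le hτ.le hsmall hσ
    hσΔ hσbad (fun x hx => hσ0 x (hcap hx)) hlow

theorem eventually_planeDiffNonneg (hd : 2 ≤ Module.finrank ℝ E)
    (hf : IsAdmissibleNonlinearity f) (hV : IsNavierSystem m Ω f V) (hΩ : IsSteinerDomain e Ω)
    (hm : 0 < m) {l₀ : ℝ} (hl₀ : 0 < l₀) (h : PlaneDiffNonneg e Ω (V 0) l₀) :
    ∀ᶠ l in 𝓝 l₀, PlaneDiffNonneg e Ω (V 0) l := by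
  borelize E
  obtain ⟨δ, hδ, hsmall⟩ := hV.exists_planeDiffNonneg_of_volume_lt hd hf hΩ hm
  obtain ⟨K, hKcap, hK, hKδ⟩ := hΩ.exists_isCompact_volume_cap_diff_lt l₀ hδ
  have hKpos : ∀ᶠ l in 𝓝 l₀, ∀ x ∈ K, 0 < planeDiff e (V 0) l x := by
    refine hK.eventually_forall_of_forall_eventually fun x hx => ?_
    obtain ⟨hmem, hmem'⟩ := hΩ.mem_diff_zero hl₀.le (hKcap hx)
    exact (continuousAt_planeDiff_prod (hV.continuousAt 0 hm x hmem.2)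
      (hV.continuousAt 0 hm _ hmem'.2)).eventually
        (lt_mem_nhds (hV.planeDiff_zero_pos hd hf hΩ hm hl₀ h x (hKcap hx)))
  filter_upwards [hKδ, hKpos, lt_mem_nhds hl₀] with l hlδ hlK hl
  exact hsmall l hl K hlδ fun x hx => (hlK x hx).le

theorem planeDiffNonneg_of_frequently (hV : IsNavierSystem m Ω f V) (hΩ : IsSteinerDomain e Ω)
    (hm : 0 < m) {l₀ : ℝ} (hl₀ : 0 ≤ l₀) (h : ∃ᶠ l in 𝓝 l₀, PlaneDiffNonneg e Ω (V 0) l) :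
    PlaneDiffNonneg e Ω (V 0) l₀ := by
  intro x hx
  by_contra! hneg
  obtain ⟨hmem, hmem'⟩ := hΩ.mem_diff_zero hl₀ hx
  have hdiff : ContinuousAt (fun l => planeDiff e (V 0) l x) l₀ :=
    ContinuousAt.comp (f := fun l : ℝ => (l, x))
      (continuousAt_planeDiff_prod (hV.continuousAt 0 hm x hmem.2)
        (hV.continuousAt 0 hm _ hmem'.2)) (by fun_prop)
  have hzero : Continuous fun l => planeReflection e l 0 :=
    (continuous_planeReflection e).comp (by fun_prop : Continuous fun l : ℝ => (l, (0 : E)))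
  obtain ⟨l, hl, hneg_l, hlx, hxl⟩ := (h.and_eventually ((hdiff.eventually (gt_mem_nhds hneg)).and
    ((gt_mem_nhds hx.1.2).and (hzero.continuousAt.eventually_ne (Ne.symm hx.2))))).exists
  exact hneg_l.not_ge (hl x ⟨⟨hx.1.1, hlx⟩, hxl.symm⟩)

/-- The levels at which the comparison holds form a nonempty, open and closed
subset of `(0, ∞)`. -/
theorem planeDiffNonneg (hd : 2 ≤ Module.finrank ℝ E) (hf : IsAdmissibleNonlinearity f)
    (hV : IsNavierSystem m Ω f V) (hΩ : IsSteinerDomain e Ω) (hm : 0 < m) (hl : 0 < l) :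
    PlaneDiffNonneg e Ω (V 0) l := by
  set G : Set ℝ := {l | 0 < l ∧ PlaneDiffNonneg e Ω (V 0) l}
  have hopen : IsOpen G := isOpen_iff_mem_nhds.2 fun l₀ hl₀ =>
    (lt_mem_nhds hl₀.1).and (hV.eventually_planeDiffNonneg hd hf hΩ hm hl₀.1 hl₀.2)
  have hne : (Ioi 0 ∩ G).Nonempty := by
    obtain ⟨R, hR, hΩR⟩ := hΩ.isBounded.subset_ball_lt 0 0
    refine ⟨R, hR, hR, fun x hx => absurd hx.1.2 (not_lt.2 ?_)⟩
    calc inner ℝ e x ≤ ‖e‖ * ‖x‖ := real_inner_le_norm e x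
      _ ≤ R := by rw [hΩ.norm_eq, one_mul]; exact (mem_ball_zero_iff.1 (hΩR hx.1.1)).le
  have hclosed : closure G ∩ Ioi 0 ⊆ G := fun l₀ ⟨hmem, (hl₀ : 0 < l₀)⟩ =>
    ⟨hl₀, hV.planeDiffNonneg_of_frequently hΩ hm hl₀.le
      ((mem_closure_iff_frequently.1 hmem).mono fun _ h => h.2)⟩
  exact (isPreconnected_Ioi.subset_of_closure_inter_subset hopen hne hclosed hl).2

theorem lt_of_inner_pos (hd : 2 ≤ Module.finrank ℝ E) (hf : IsAdmissibleNonlinearity f)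
    (hV : IsNavierSystem m Ω f V) (hΩ : IsSteinerDomain e Ω) (hm : 0 < m)
    (hx : 0 < (inner ℝ e x : ℝ)) {t : ℝ} (ht : 0 < t) (hxt : x + t • e ∈ Ω) :
    V 0 (x + t • e) < V 0 x := by
  have hinner := inner_add_smul_self hΩ.norm_eq x t
  set l : ℝ := inner ℝ e x + t / 2 with hl_def
  have hl : 0 < l := by positivity
  have hrefl : planeReflection e l (x + t • e) = x := by
    rw [planeReflection_add_smul_self hΩ.norm_eq, hl_def]
    module
  have hmem : x + t • e ∈ puncturedCap e Ω l := by
    refine ⟨⟨hxt, by linarith⟩, fun h => ne_zero_of_inner_pos hx ?_⟩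
    rw [← hrefl, mem_singleton_iff.1 h, planeReflection_planeReflection hΩ.norm_eq]
  have hpos := hV.planeDiff_zero_pos hd hf hΩ hm hl (hV.planeDiffNonneg hd hf hΩ hm hl) _ hmem
  rwa [planeDiff, hrefl, sub_pos] at hpos

theorem le_planeReflection (hd : 2 ≤ Module.finrank ℝ E) (hf : IsAdmissibleNonlinearity f)
    (hV : IsNavierSystem m Ω f V) (hΩ : IsSteinerDomain e Ω) (hm : 0 < m) (hxΩ : x ∈ Ω)
    (hx : 0 < (inner ℝ e x : ℝ)) : V 0 x ≤ V 0 (planeReflection e 0 x) := by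
  have hev : ∀ᶠ l in 𝓝[>] (0 : ℝ), PlaneDiffNonneg e Ω (V 0) l :=
    eventually_mem_nhdsWithin.mono fun l hl => hV.planeDiffNonneg hd hf hΩ hm hl
  have hfreq : ∃ᶠ l in 𝓝 (0 : ℝ), PlaneDiffNonneg e Ω (V 0) l :=
    hev.frequently.filter_mono nhdsWithin_le_nhds
  refine sub_nonneg.1 (hV.planeDiffNonneg_of_frequently hΩ hm le_rfl hfreq x ⟨⟨hxΩ, hx⟩, ?_⟩)
  simpa [planeReflection_zero_right] using ne_zero_of_inner_pos hx

theorem planeReflection_eq (hd : 2 ≤ Module.finrank ℝ E) (hf : IsAdmissibleNonlinearity f)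
    (hV : IsNavierSystem m Ω f V) (hΩ : IsSteinerDomain e Ω) (hm : 0 < m) (hx : x ∈ Ω) :
    V 0 (planeReflection e 0 x) = V 0 x := by
  have hinner : ∀ y, inner ℝ e (planeReflection e 0 y) = -inner ℝ e y := fun y => by
    rw [inner_planeReflection hΩ.norm_eq]
    ring
  have hpos : ∀ y ∈ Ω, 0 < (inner ℝ e y : ℝ) → V 0 (planeReflection e 0 y) = V 0 y := by
    intro y hy hey
    refine le_antisymm ?_ (hV.le_planeReflection hd hf hΩ hm hy hey)
    have hle := hV.le_planeReflection hd hf hΩ.neg hm (hΩ.planeReflection_zero_mem hy)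
      (by rwa [inner_neg_left, hinner, neg_neg])
    rwa [planeReflection_neg, planeReflection_planeReflection hΩ.norm_eq] at hle
  rcases lt_trichotomy (inner ℝ e x : ℝ) 0 with h | h | h
  · have heq := hpos _ (hΩ.planeReflection_zero_mem hx) (by rw [hinner]; linarith)
    rw [planeReflection_planeReflection hΩ.norm_eq] at heq
    exact heq.symm
  · rw [planeReflection_of_inner_eq h]
  · exact hpos x hx h

theorem eq_of_norm_eq {R : ℝ} (hd : 2 ≤ Module.finrank ℝ E) (hf : IsAdmissibleNonlinearity f)
    (hV : IsNavierSystem m (Metric.ball 0 R) f V) (hm : 0 < m) {y : E}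
    (hx : x ∈ Metric.ball 0 R) (hxy : ‖x‖ = ‖y‖) : V 0 x = V 0 y := by
  by_cases hne : x = y
  · rw [hne]
  · have he : ‖‖x - y‖⁻¹ • (x - y)‖ = 1 := norm_smul_inv_norm (𝕜 := ℝ) (sub_ne_zero.2 hne)
    rw [← planeReflection_bisector hxy hne,
      hV.planeReflection_eq hd hf (isSteinerDomain_ball he R) hm hx]

theorem strictAntiOn_smul {R : ℝ} (hd : 2 ≤ Module.finrank ℝ E)
    (hf : IsAdmissibleNonlinearity f) (hV : IsNavierSystem m (Metric.ball 0 R) f V) (hm : 0 < m)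
    (he : ‖e‖ = 1) : StrictAntiOn (fun r : ℝ => V 0 (r • e)) (Ioo 0 R) := by
  intro r hr s hs hrs
  have hadd : r • e + (s - r) • e = s • e := by module
  have hlt := hV.lt_of_inner_pos hd hf (isSteinerDomain_ball he R) hm (x := r • e)
    (by simpa [real_inner_smul_right, he] using hr.1) (sub_pos.2 hrs)
    (by rw [hadd, mem_ball_zero_iff, norm_smul, he, mul_one, Real.norm_of_nonneg hs.1.le]
        exact hs.2)
  rwa [hadd] at hlt

end IsNavierSystem

end MovingPlanes

section NavierSolution

open Laplacian

variable {E : Type*} [NormedAddCommGroup E] [InnerProductSpace ℝ E] [FiniteDimensional ℝ E]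
  {m j k : ℕ} {Ω : Set E} {f : ℝ → ℝ} {u v : E → ℝ} {e x : E}

theorem contDiffOn_neg_laplacian (hΩ : IsOpen Ω)
    (hv : ContDiffOn ℝ ((k + 2 : ℕ) : WithTop ℕ∞) v Ω) :
    ContDiffOn ℝ (k : WithTop ℕ∞) ((-Δ) v) Ω := by
  have hfderiv : ContDiffOn ℝ ((k + 1 : ℕ) : WithTop ℕ∞) (fderiv ℝ v) Ω :=
    hv.fderiv_of_isOpen hΩ (by norm_cast)
  have hfderiv₂ : ContDiffOn ℝ (k : WithTop ℕ∞) (fderiv ℝ (fderiv ℝ v)) Ω :=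
    hfderiv.fderiv_of_isOpen hΩ (by norm_cast)
  have hsum : (-Δ) v = fun x => -∑ i, fderiv ℝ (fderiv ℝ v) x
      (stdOrthonormalBasis ℝ E i) (stdOrthonormalBasis ℝ E i) :=
    funext fun x => congrArg Neg.neg (laplacian_eq_sum_fderiv_fderiv (stdOrthonormalBasis ℝ E) v x)
  rw [hsum]
  exact (ContDiffOn.sum fun i _ =>
    (hfderiv₂.clm_apply contDiffOn_const).clm_apply contDiffOn_const).neg

theorem contDiffOn_iterate_neg_laplacian (hΩ : IsOpen Ω) (j : ℕ)
    (hv : ContDiffOn ℝ ((k + 2 * j : ℕ) : WithTop ℕ∞) v Ω) :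
    ContDiffOn ℝ (k : WithTop ℕ∞) ((-Δ)^[j] v) Ω := by
  induction j generalizing k with
  | zero => simpa using hv
  | succ j ih =>
    rw [Function.iterate_succ_apply']
    refine contDiffOn_neg_laplacian hΩ (ih ?_)
    convert hv using 2
    ring

/-- A positive classical solution of `(-Δ)^m u = f(u)` in `Ω \ {0}` with Navier conditions on the
boundary and `(-Δ)^j u` bounded below for `1 ≤ j < m`, on an arbitrary Euclidean space. -/
structure IsNavierSolution (m : ℕ) (Ω : Set E) (f : ℝ → ℝ) (u : E → ℝ) : Prop where
  contDiffOn : ContDiffOn ℝ ((2 * m : ℕ) : WithTop ℕ∞) u (Ω \ {0})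
  equation : ∀ x ∈ Ω \ {0}, (-Δ)^[m] u x = f (u x)
  pos : ∀ x ∈ Ω \ {0}, 0 < u x
  navier : ∀ j < m, ∀ y ∈ frontier Ω, Tendsto ((-Δ)^[j] u) (𝓝[Ω \ {0}] y) (𝓝 0)
  bddBelow : ∀ j, 1 ≤ j → j < m → BddBelow ((-Δ)^[j] u '' (Ω \ {0}))

/-- The power `(-Δ)^j u`, extended by zero from `Ω \ {0}`. -/
noncomputable def extendedPower (Ω : Set E) (u : E → ℝ) (j : ℕ) : E → ℝ :=
  (Ω \ {0}).indicator ((-Δ)^[j] u)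

theorem extendedPower_of_mem (hx : x ∈ Ω \ {0}) : extendedPower Ω u j x = (-Δ)^[j] u x :=
  indicator_of_mem hx _

theorem extendedPower_of_notMem (hx : x ∉ Ω) : extendedPower Ω u j x = 0 :=
  indicator_of_notMem (fun h => hx h.1) _

theorem extendedPower_eventuallyEq (hΩ : IsOpen Ω) (hx : x ∈ Ω \ {0}) :
    extendedPower Ω u j =ᶠ[𝓝 x] (-Δ)^[j] u := by
  filter_upwards [(hΩ.sdiff isClosed_singleton).mem_nhds hx] with y hy
    using extendedPower_of_mem hy

namespace IsNavierSolution

theorem contDiffAt_extendedPower (hu : IsNavierSolution m Ω f u) (hΩ : IsOpen Ω) (hj : j < m)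
    (hx : x ∈ Ω \ {0}) : ContDiffAt ℝ 2 (extendedPower Ω u j) x := by
  have hU : IsOpen (Ω \ {0}) := hΩ.sdiff isClosed_singleton
  have hcd : ContDiffOn ℝ ((2 + 2 * j : ℕ) : WithTop ℕ∞) u (Ω \ {0}) :=
    hu.contDiffOn.of_le (by norm_cast; omega)
  exact ((contDiffOn_iterate_neg_laplacian hU j hcd).contDiffAt
    (hU.mem_nhds hx)).congr_of_eventuallyEq (extendedPower_eventuallyEq hΩ hx)

theorem continuousAt_extendedPower (hu : IsNavierSolution m Ω f u) (hΩ : IsOpen Ω) (hj : j < m)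
    (hx : x ≠ 0) : ContinuousAt (extendedPower Ω u j) x := by
  by_cases hxΩ : x ∈ Ω
  · exact (hu.contDiffAt_extendedPower hΩ hj ⟨hxΩ, hx⟩).continuousAt
  rw [ContinuousAt, extendedPower_of_notMem hxΩ]
  by_cases hxc : x ∈ closure Ω
  · have hlim := hu.navier j hj x ⟨hxc, by rwa [hΩ.interior_eq]⟩
    refine fun N hN => mem_map.2 ?_
    filter_upwards [mem_nhdsWithin_iff_eventually.1 (hlim hN)] with y hy
    by_cases hyΩ : y ∈ Ω \ {0}
    · rw [mem_preimage, extendedPower_of_mem hyΩ]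
      exact hy hyΩ
    · rw [mem_preimage, extendedPower, indicator_of_notMem hyΩ]
      exact mem_of_mem_nhds hN
  · refine tendsto_const_nhds.congr' ?_
    filter_upwards [isClosed_closure.isOpen_compl.mem_nhds hxc] with y hy
    exact (extendedPower_of_notMem fun h => hy (subset_closure h)).symm

theorem isNavierSystem (hu : IsNavierSolution m Ω f u) (hΩ : IsOpen Ω) :
    IsNavierSystem m Ω f (extendedPower Ω u) where
  contDiffAt _ hj _ hx := hu.contDiffAt_extendedPower hΩ hj hx
  laplacian_eq j _ x hx := by
    rw [(InnerProductSpace.laplacian_congr_nhds (extendedPower_eventuallyEq hΩ hx)).eq_of_nhds,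
      extendedPower_of_mem hx, Function.iterate_succ_apply', Pi.neg_apply, Pi.neg_apply, neg_neg]
  last_eq x hx := by
    rw [extendedPower_of_mem hx, extendedPower_of_mem hx, hu.equation x hx, Function.iterate_zero,
      id]
  pos x hx := by
    rw [extendedPower_of_mem hx]
    exact hu.pos x hx
  continuousAt _ hj _ hx := hu.continuousAt_extendedPower hΩ hj hx
  eq_zero _ _ _ hx := extendedPower_of_notMem hx
  bddBelow j hj := by
    rw [image_congr fun x hx => extendedPower_of_mem hx]
    rcases Nat.eq_zero_or_pos j with rfl | hj0
    · exact ⟨0, forall_mem_image.2 fun x hx => (hu.pos x hx).le⟩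
    · exact hu.bddBelow j hj0 hj

end IsNavierSolution

theorem theorem1p1_general (hd : 2 ≤ Module.finrank ℝ E) (hm : 0 < m) (hΩ : IsSteinerDomain e Ω)
    (hf : IsAdmissibleNonlinearity f) (hu : IsNavierSolution m Ω f u) :
    (∀ x ∈ Ω \ {0}, u (planeReflection e 0 x) = u x) ∧
    (∀ x ∈ Ω, ∀ y ∈ Ω, y - x ∈ ℝ ∙ e → 0 < (inner ℝ e x : ℝ) →
      (inner ℝ e x : ℝ) < inner ℝ e y → u y < u x) ∧
    (∀ R : ℝ, Ω = Metric.ball 0 R →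
      ∃ φ : ℝ → ℝ, (∀ x ∈ Ω \ {0}, u x = φ ‖x‖) ∧ StrictAntiOn φ (Ioo 0 R)) := by
  have hV := hu.isNavierSystem hΩ.isOpen
  have hVu : ∀ x ∈ Ω, x ≠ 0 → extendedPower Ω u 0 x = u x := fun x hx hx0 =>
    extendedPower_of_mem ⟨hx, hx0⟩
  refine ⟨fun x hx => ?_, fun x hx y hy hxy hx0 hlt => ?_, ?_⟩
  · have hne : planeReflection e 0 x ≠ 0 :=
      planeReflection_ne_zero hΩ.norm_eq (by simpa [planeReflection_zero_right] using hx.2)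
    rw [← hVu x hx.1 hx.2, ← hVu _ (hΩ.planeReflection_zero_mem hx.1) hne,
      hV.planeReflection_eq hd hf hΩ hm hx.1]
  · obtain ⟨t, ht⟩ := Submodule.mem_span_singleton.1 hxy
    obtain rfl : y = x + t • e := by rw [ht, add_sub_cancel]
    rw [inner_add_smul_self hΩ.norm_eq] at hlt
    rw [← hVu x hx (ne_zero_of_inner_pos hx0), ← hVu _ hy (ne_zero_of_inner_pos (e := e) ?_)]
    · exact hV.lt_of_inner_pos hd hf hΩ hm hx0 (by linarith) hy
    · rw [inner_add_smul_self hΩ.norm_eq]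
      linarith
  · rintro R rfl
    refine ⟨fun r => extendedPower _ u 0 (r • e), fun x hx => ?_,
      hV.strictAntiOn_smul hd hf hm hΩ.norm_eq⟩
    rw [← hVu x hx.1 hx.2]
    exact hV.eq_of_norm_eq hd hf hm hx.1 (by rw [norm_smul, hΩ.norm_eq, norm_norm, mul_one])

end NavierSolution

section Coordinates

variable {n : ℕ} {i : Fin n} {x y : EuclideanSpace ℝ (Fin n)}

theorem inner_single_one (i : Fin n) (x : EuclideanSpace ℝ (Fin n)) :
    inner ℝ (EuclideanSpace.single i (1 : ℝ)) x = x i := by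
  simp [EuclideanSpace.inner_single_left]

theorem planeReflection_single (i : Fin n) (x : EuclideanSpace ℝ (Fin n)) :
    planeReflection (EuclideanSpace.single i (1 : ℝ)) 0 x = coordReflection i x := by
  ext j
  rw [planeReflection, inner_single_one, coordReflection]
  by_cases h : j = i
  · subst h
    simp only [PiLp.add_apply, PiLp.smul_apply, PiLp.single_eq_same, smul_eq_mul, mul_one,
      ↓reduceIte]
    ring
  · simp [h]

theorem sub_mem_span_single (h : ∀ j, j ≠ i → x j = y j) :
    y - x ∈ ℝ ∙ EuclideanSpace.single i (1 : ℝ) := by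
  refine Submodule.mem_span_singleton.2 ⟨y i - x i, ?_⟩
  ext j
  by_cases hj : j = i
  · subst hj
    simp
  · simp [hj, h j hj]

theorem IsSymmetricConvexDomain.isSteinerDomain {Ω : Set (EuclideanSpace ℝ (Fin n))}
    (hΩ : IsSymmetricConvexDomain i Ω) : IsSteinerDomain (EuclideanSpace.single i (1 : ℝ)) Ω where
  norm_eq := by simp
  isOpen := hΩ.isOpen
  isBounded := hΩ.isBounded
  slide x hx t ht := by
    rw [inner_single_one] at ht ⊢
    rcases eq_or_ne (x i) 0 with h0 | h0
    · rw [h0, abs_zero, abs_nonpos_iff] at ht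
      simpa [h0, ht] using hx
    · have habs : |t / x i| ≤ 1 := by
        rw [abs_div]
        exact div_le_one_of_le₀ ht (abs_nonneg _)
      have hcomb := hΩ.convex_dir x hx _ (hΩ.reflection_mem x hx)
        (fun j hj => by simp [coordReflection, hj]) ((1 - t / x i) / 2)
        ⟨by linarith [(abs_le.1 habs).2], by linarith [(abs_le.1 habs).1]⟩
      have hcoeff : t - x i = (1 - t / x i) / 2 * (2 * (0 - x i)) := by
        field_simp
        ring
      convert hcomb using 1
      rw [← planeReflection_single, planeReflection, inner_single_one, hcoeff]
      module

theorem IsPositiveNavierSolution.isNavierSolution {m : ℕ} {Ω : Set (EuclideanSpace ℝ (Fin n))}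
    {f : ℝ → ℝ} {u : EuclideanSpace ℝ (Fin n) → ℝ} (hu : IsPositiveNavierSolution m Ω f u) :
    IsNavierSolution m Ω f u where
  contDiffOn := hu.contDiffOn
  equation := hu.equation
  pos := hu.pos
  navier := hu.navier
  bddBelow := hu.bddBelow

end Coordinates

theorem theorem1p1 {n m : ℕ} (hn : 2 ≤ n) (hm : 1 ≤ m)
    (Ω : Set (EuclideanSpace ℝ (Fin n)))
    (hΩ : IsSymmetricConvexDomain (⟨0, by omega⟩ : Fin n) Ω)
    (f : ℝ → ℝ) (hf : IsAdmissibleNonlinearity f)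
    (u : EuclideanSpace ℝ (Fin n) → ℝ) (hu : IsPositiveNavierSolution m Ω f u) :
    -- symmetry in the first coordinate
    (∀ x ∈ Ω \ {0}, u (coordReflection ⟨0, by omega⟩ x) = u x) ∧
    -- strict decrease in the first coordinate where it is positive
    (∀ x ∈ Ω, ∀ y ∈ Ω, (∀ j : Fin n, j ≠ ⟨0, by omega⟩ → x j = y j) →
      0 < x ⟨0, by omega⟩ → x ⟨0, by omega⟩ < y ⟨0, by omega⟩ → u y < u x) ∧
    -- on a ball centred at the origin: radial and strictly radially decreasing
    (∀ R : ℝ, 0 < R → Ω = Metric.ball 0 R →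
      ∃ φ : ℝ → ℝ, (∀ x ∈ Ω \ {0}, u x = φ ‖x‖) ∧ StrictAntiOn φ (Ioo 0 R)) := by
  have h := theorem1p1_general (by simpa using hn) hm hΩ.isSteinerDomain hf hu.isNavierSolution
  simp only [planeReflection_single, inner_single_one] at h
  exact ⟨h.1, fun x hx y hy hxy => h.2.1 x hx y hy (sub_mem_span_single hxy), fun R _ => h.2.2 R⟩
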